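/- Let $d\ge 1$, $C_0\ge 1$, and let $\theta_1=1$ and $\theta_2,\dots,\theta_d\in[1/C_0,C_0]$ be real numbers. Put $Q(\mathbf n)=n_1^2+\theta_2n_2^2+\cdots+\theta_dn_d^2$ for $\mathbf n\in\mathbb Z^d$, and for $f$ on $\mathbb T^d=(\mathbb R/\mathbb Z)^d$ let $$\big(e^{-it\Delta}f\big)(\mathbf x)=\sum_{\mathbf n\in\mathbb Z^d}\widehat f(\mathbf n)\,e^{2\pi i(\mathbf n\cdot\mathbf x+Q(\mathbf n)t)} .$$ Let $I\subset\mathbb R$ be a compact interval, $N\ge 1$ an integer, $S_N=\{\mathbf n\in\mathbb Z^d:\ |n_j|\le N,\ j=1,\dots,d\}$, and let $f(\mathbf x)=\sum_{\mathbf n\in S_N}c_{\mathbf n}e^{2\pi i\mathbf n\cdot\mathbf x}$ with $c_{\mathbf n}\in\mathbb C$ and $\sum_{\mathbf n\in S_N}|c_{\mathbf n}|^2=1$. For $\lambda>0$ set $$A_\lambda=\big\{(\mathbf x,t)\in\mathbb T^d\times I:\ |(e^{-it\Delta}f)(\mathbf x)|>\lambda\big\},$$ and let $|A_\lambda|$ be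 its Lebesgue measure. (i) For every $\varepsilon>0$ and every $\kappa>0$ there is a constant $C$ such that $$|A_\lambda|\le C\,N^{2(d-1)\frac{1}{1+6\varepsilon}}\,\lambda^{-6+\frac{24}{1+6\varepsilon}\varepsilon}\qquad\text{whenever }\lambda\ge\kappa N^{\frac d2-\frac14+\varepsilon}.$$ (ii) For every $q>6$ there is $\varepsilon>0$, depending only on $d$ and $q$, such that for every $\kappa>0$ there is a constant $C$ with $$|A_\lambda|\le C\,N^{\frac d2q-(d+2)}\,\lambda^{-q}\qquad\text{whenever }\lambda\ge\kappa N^{\frac d2-\varepsilon}.$$ The constants $C$ depend only on $d$, $C_0$, the length $|I|$, $\kappa$, and on $\varepsilon$ in (i), respectively $q$ in (ii); they do not depend on $f$, $N$, $\lambda$, the position of $I$, or on the $\theta_j$ other than through $C_0$. -/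

import Mathlib

open MeasureTheory

noncomputable section

namespace IrrationalTorus

/-- The quadratic form `Q(n) = θ₁ n₁² + ⋯ + θ_d n_d²` on `ℤᵈ`. -/
def quadForm {d : ℕ} (θ : Fin d → ℝ) (n : Fin d → ℤ) : ℝ :=
  ∑ j, θ j * (n j : ℝ) ^ 2

/-- The linear Schrödinger evolution on `𝕋ᵈ = (ℝ/ℤ)ᵈ` associated with `Q`:
`(e^{-itΔ} f)(x) = ∑ₙ f̂(n) e^{2πi (n·x + Q(n) t)}`, where `mFourierCoeff f n = f̂(n)` and
`mFourier n x = e^{2πi n·x}`. -/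
def schrodingerEvolution {d : ℕ} (θ : Fin d → ℝ) (f : UnitAddTorus (Fin d) → ℂ)
    (x : UnitAddTorus (Fin d)) (t : ℝ) : ℂ :=
  ∑' n : Fin d → ℤ, UnitAddTorus.mFourierCoeff f n *
    (UnitAddTorus.mFourier n x * Complex.exp (2 * Real.pi * Complex.I * (quadForm θ n * t : ℝ)))

/-- The frequency box `S_N = {n ∈ ℤᵈ : |n_j| ≤ N for all j}`. -/
def freqBox (d N : ℕ) : Finset (Fin d → ℤ) :=
  Fintype.piFinset fun _ => Finset.Icc (-(N : ℤ)) (N : ℤ)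

/-- The trigonometric polynomial `f(x) = ∑_{n ∈ S_N} c_n e^{2πi n·x}`. -/
def trigPoly {d : ℕ} (N : ℕ) (c : (Fin d → ℤ) → ℂ) (x : UnitAddTorus (Fin d)) : ℂ :=
  ∑ n ∈ freqBox d N, c n * UnitAddTorus.mFourier n x

/-- The level set `A_λ = {(x, t) ∈ 𝕋ᵈ × I : |(e^{-itΔ} f)(x)| > λ}`. -/
def levelSet {d : ℕ} (θ : Fin d → ℝ) (f : UnitAddTorus (Fin d) → ℂ) (I : Set ℝ) (lam : ℝ) :
    Set (UnitAddTorus (Fin d) × ℝ) :=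
  {p | p.2 ∈ I ∧ lam < ‖schrodingerEvolution θ f p.1 p.2‖}

end IrrationalTorus

end

noncomputable section

namespace IrrationalTorus

open Real

/-! ### Additive characters and Gaussian sums -/

/-! On a time slab of unit length the exponentials e(n·x + (Q(n) + k)t), with (n, k) in ℤᵈ × ℤ, are
orthonormal whatever real numbers the Q(n) are: distinct n are separated by x, and for equal n the
factor e(Q(n)t) cancels (`integral_conj_stExp_mul`). Multiplying the kernel K = ∑ w_n e(n·x + Q(n)t)
by a 1-periodic function Λ(t) = ∑ L_k e(kt) therefore gives an operator that is diagonal in this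
system, with entries w_n L_k. Here w is a Gaussian weight, bounded below on S_N and well suited to
Poisson summation.

Let F be the evolution, A its level set in the slab, m = |A| and Θ = 1_A F/|F|. Duality gives λ²m² ≤
∑ |⟨Θ, e_{n,0}⟩|² over S_N. Take Λ to be a smoothed indicator of the arcs of half-width Q/(qN²)
around the fractions a/q with q ≤ Q, and test K(1 - Λ) against Θ. Its supremum is controlled because
θ₁ = 1: the first coordinate contributes a quadratic Weyl sum, which is O(N Q^{-1/2} + N^{1/2}) off
the arcs (`norm_weylSum_minor`), and the other coordinates contribute O(N^{d-1}).

The entries with k ≠ 0 are the remaining error. The L_k are combinations of Ramanujan sums, of size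
Q/N² times a divisor function restricted to divisors at most Q. Bounding them by their supremum
would lose a power N^ε. Instead they are split at a height D: the part below D costs D·m by Bessel,
and the part above is paid for by the high moments ∑ |L_k|^{s+1} = O(Q^{s+2} N^{-2s})
(`exists_sum_norm_arcCoeff_pow_le`), which lose only powers of Q. This is carried out in
`level_set_bound_of_multiplier`.

With M of order N^d/λ², Q of order M² and D of order M^{2+η}/N², every term in m² is absorbed by
λ²m², leaving m = O(D/λ²). This is the lossless estimate with exponent 6 + 2η. The argument requires
N to be at least a multiple of M², that is, λ of order at least N^{d/2-1/4}; an extra N^ε in λ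
guarantees it except for boundedly many N, where the estimate is trivial. Statement (ii) is this
estimate, and (i) follows by trading surplus powers of λ for powers of N. -/

/-- The character `y ↦ e^{2πiy}` of `ℝ`. -/
def expi (y : ℝ) : ℂ := Complex.exp (2 * Real.pi * Complex.I * (y : ℝ))

lemma expi_add (x y : ℝ) : expi (x + y) = expi x * expi y := by
  simp only [expi, ← Complex.exp_add]
  push_cast
  ring_nf

lemma norm_expi (y : ℝ) : ‖expi y‖ = 1 := by
  rw [expi, show 2 * (π : ℂ) * Complex.I * (y : ℂ) = ((2 * π * y : ℝ) : ℂ) * Complex.I by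
    push_cast; ring]
  exact Complex.norm_exp_ofReal_mul_I _

lemma expi_zero : expi 0 = 1 := by simp [expi]

lemma expi_int (n : ℤ) : expi n = 1 := by
  rw [expi, Complex.ofReal_intCast, show 2 * (π : ℂ) * Complex.I * (n : ℂ) =
    n * (2 * π * Complex.I) by ring]
  exact Complex.exp_int_mul_two_pi_mul_I n

lemma expi_neg (y : ℝ) : expi (-y) = (starRingEnd ℂ) (expi y) := by
  simp only [expi, ← Complex.exp_conj]
  congr 1
  simp only [map_mul, Complex.conj_ofReal, Complex.conj_I, map_ofNat]
  push_cast
  ring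

lemma continuous_expi : Continuous expi := by unfold expi; fun_prop

lemma summable_gauss {s : ℝ} (hs : 0 < s) (y : ℝ) :
    Summable fun n : ℤ => rexp (-π * s * (n + y) ^ 2) := by
  have h := ((summable_jacobiTheta₂_term_iff (Complex.I * (s * y : ℝ)) (Complex.I * s)).2
    (by simpa using hs)).norm.mul_left (rexp (-π * s * y ^ 2))
  refine h.congr fun n => ?_
  rw [norm_jacobiTheta₂_term, ← Real.exp_add]
  congr 1
  simp
  ring

lemma summable_gauss_zero {s : ℝ} (hs : 0 < s) :
    Summable fun n : ℤ => rexp (-π * s * (n : ℝ) ^ 2) := by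
  simpa using summable_gauss hs 0

/-- The constant `∑ₙ e^{-πn²}`. -/
def gaussConst : ℝ := ∑' n : ℤ, rexp (-π * 1 * (n : ℝ) ^ 2)

lemma one_le_gaussConst : 1 ≤ gaussConst := by
  have := (summable_gauss_zero one_pos).le_tsum 0 fun n _ => (Real.exp_pos _).le
  simpa [gaussConst] using this

/-- For s ≥ 1 the terms are dominated by those at s = 1; for s ≤ 1 the theta functional equation
passes to 1/s ≥ 1 at the cost of the factor s^{-1/2}. -/
lemma tsum_gauss_zero_le {s : ℝ} (hs : 0 < s) :
    ∑' n : ℤ, rexp (-π * s * (n : ℝ) ^ 2) ≤ gaussConst * (1 + 1 / √s) := by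
  have mono : ∀ r : ℝ, 1 ≤ r → ∑' n : ℤ, rexp (-π * r * (n : ℝ) ^ 2) ≤ gaussConst := by
    intro r hr
    refine (summable_gauss_zero (by linarith)).tsum_le_tsum (fun n => ?_)
      (summable_gauss_zero one_pos)
    apply Real.exp_le_exp.2
    have : 0 ≤ π * (n : ℝ) ^ 2 := by positivity
    nlinarith
  have hg := one_le_gaussConst
  rcases le_total 1 s with h | h
  · refine (mono s h).trans ?_
    have : 0 ≤ gaussConst * (1 / √s) := by positivity
    linarith
  · rw [Real.tsum_exp_neg_mul_int_sq hs, ← Real.sqrt_eq_rpow]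
    have h1 := mono (1 / s) (by rw [le_div_iff₀ hs]; linarith)
    have h2 : ∑' n : ℤ, rexp (-π / s * (n : ℝ) ^ 2) ≤ gaussConst := by
      convert h1 using 5
      ring
    have : 1 / √s * ∑' n : ℤ, rexp (-π / s * (n : ℝ) ^ 2) ≤ 1 / √s * gaussConst := by gcongr
    linarith

/-- A Gaussian sum over a shifted lattice is at most a constant times `1 + s^{-1/2}`. -/
lemma tsum_gauss_le {s : ℝ} (hs : 0 < s) (y : ℝ) :
    ∑' n : ℤ, rexp (-π * s * (n + y) ^ 2) ≤ gaussConst * (1 + 1 / √s) := by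
  refine le_trans ?_ (tsum_gauss_zero_le hs)
  have hs' : 0 < (1 / s : ℝ) := by positivity
  -- Poisson summation for the shifted and the unshifted sum: on the dual side the shift is a
  -- unimodular phase, so the shifted sum is the smaller one.
  have key := Complex.tsum_exp_neg_quadratic (a := ((1 / s : ℝ) : ℂ))
    (by rw [Complex.ofReal_re]; exact hs') (-Complex.I * y)
  have h0 := Complex.tsum_exp_neg_mul_int_sq (a := ((1 / s : ℝ) : ℂ))
    (by rw [Complex.ofReal_re]; exact hs')
  have hne : (((1 / s : ℝ) : ℂ)) ^ (1 / 2 : ℂ) ≠ 0 := by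
    rw [Complex.cpow_ne_zero_iff]; left; exact_mod_cast hs'.ne'
  have e1 : ((∑' n : ℤ, rexp (-π * s * (n + y) ^ 2) : ℝ) : ℂ) =
      ((1 / s : ℝ) : ℂ) ^ (1 / 2 : ℂ) * ∑' n : ℤ, Complex.exp (-π * ((1 / s : ℝ) : ℂ) * n ^ 2 +
        2 * π * (-Complex.I * y) * n) := by
    rw [key, ← mul_assoc, mul_one_div_cancel hne, one_mul, Complex.ofReal_tsum]
    refine tsum_congr fun n => ?_
    push_cast
    congr 1
    rw [← mul_assoc, mul_neg, Complex.I_mul_I]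
    field_simp
  have e2 : ((∑' n : ℤ, rexp (-π * s * (n : ℝ) ^ 2) : ℝ) : ℂ) =
      ((1 / s : ℝ) : ℂ) ^ (1 / 2 : ℂ) *
        ((∑' n : ℤ, rexp (-π * (1 / s) * (n : ℝ) ^ 2) : ℝ) : ℂ) := by
    have : ((∑' n : ℤ, rexp (-π * (1 / s) * (n : ℝ) ^ 2) : ℝ) : ℂ) =
        ∑' n : ℤ, Complex.exp (-π * ((1 / s : ℝ) : ℂ) * (n : ℂ) ^ 2) := by
      rw [Complex.ofReal_tsum]; push_cast; rfl
    rw [this, h0, ← mul_assoc, mul_one_div_cancel hne, one_mul, Complex.ofReal_tsum]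
    refine tsum_congr fun n => ?_
    push_cast
    congr 1
    field_simp
  have n1 := congrArg norm e1
  have n2 := congrArg norm e2
  rw [Complex.norm_real, Real.norm_of_nonneg (tsum_nonneg fun n => (Real.exp_pos _).le),
    norm_mul] at n1 n2
  rw [Complex.norm_real, Real.norm_of_nonneg (tsum_nonneg fun n => (Real.exp_pos _).le)] at n2
  rw [n1, n2]
  gcongr
  refine tsum_of_norm_bounded (summable_gauss_zero hs').hasSum fun n => ?_
  rw [Complex.norm_exp]
  apply le_of_eq
  congr 1
  rw [show -(π : ℂ) * ((1 / s : ℝ) : ℂ) * (n : ℂ) ^ 2 + 2 * π * (-Complex.I * y) * n =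
    ((-π * (1 / s) * (n : ℝ) ^ 2 : ℝ) : ℂ) + ((-2 * π * y * n : ℝ) : ℂ) * Complex.I by
      push_cast; ring]
  simp only [Complex.add_re, Complex.ofReal_re, Complex.mul_re, Complex.I_re, Complex.I_im,
    Complex.ofReal_im]
  ring

/-! ### Quadratic Gauss sums -/

/-- The quadratic Gauss sum `∑_r e((a r² + j r)/q)`. -/
def gaussSum (q : ℕ) [NeZero q] (a j : ZMod q) : ℂ :=
  ∑ r : ZMod q, ZMod.stdAddChar (a * r ^ 2 + j * r)

lemma norm_stdAddChar {q : ℕ} [NeZero q] (x : ZMod q) : ‖ZMod.stdAddChar x‖ = 1 := by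
  rw [ZMod.stdAddChar_apply]; exact Circle.norm_coe _

/-- Weyl differencing: for a fixed difference h the sum over r is a complete linear character sum,
zero unless 2ah = 0. As a is a unit, at most two residues h survive; the factor 2 accounts for even
q. -/
lemma norm_gaussSum_sq_le (q : ℕ) [NeZero q] {a : ZMod q} (ha : IsUnit a) (j : ZMod q) :
    ‖gaussSum q a j‖ ^ 2 ≤ 2 * q := by
  have hconj : ∀ x : ZMod q, (starRingEnd ℂ) (ZMod.stdAddChar x) = ZMod.stdAddChar (-x) := by
    intro x
    rw [AddChar.map_neg_eq_inv, Complex.inv_def, Complex.normSq_eq_norm_sq, norm_stdAddChar]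
    simp
  have h1 : ((‖gaussSum q a j‖ ^ 2 : ℝ) : ℂ) =
      ∑ h : ZMod q, ZMod.stdAddChar (a * h ^ 2 + j * h) *
        ∑ r : ZMod q, ZMod.stdAddChar (r * (2 * a * h)) := by
    push_cast
    rw [← Complex.mul_conj', gaussSum, map_sum, Finset.sum_mul_sum, Finset.sum_comm]
    simp_rw [hconj, ← AddChar.map_add_eq_mul, Finset.mul_sum, ← AddChar.map_add_eq_mul]
    rw [Finset.sum_comm (γ := ZMod q) (s := Finset.univ) (t := Finset.univ)
      (f := fun h r => ZMod.stdAddChar (a * h ^ 2 + j * h + r * (2 * a * h)))]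
    refine Finset.sum_congr rfl fun r _ => ?_
    refine Fintype.sum_equiv (Equiv.subRight r) _ _ fun s => ?_
    congr 1
    simp only [Equiv.subRight_apply]
    ring
  simp_rw [AddChar.sum_mulShift _ (ZMod.isPrimitive_stdAddChar q)] at h1
  have h2 : ‖((‖gaussSum q a j‖ ^ 2 : ℝ) : ℂ)‖ ≤
      ∑ h : ZMod q, if 2 * a * h = 0 then (q : ℝ) else 0 := by
    rw [h1]
    refine (norm_sum_le _ _).trans (Finset.sum_le_sum fun h _ => ?_)
    rw [norm_mul, norm_stdAddChar, one_mul]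
    split_ifs <;> simp [ZMod.card]
  rw [Complex.norm_real, Real.norm_of_nonneg (by positivity), ← Finset.sum_filter,
    Finset.sum_const, nsmul_eq_mul] at h2
  refine h2.trans ?_
  gcongr
  have h3 := IsAddCyclic.card_nsmul_eq_zero_le (α := ZMod q) (n := 2) two_pos
  refine le_trans ?_ (Nat.cast_le.2 h3)
  refine Nat.cast_le.2 (Finset.card_le_card fun h hh => ?_)
  simp only [Finset.mem_filter, Finset.mem_univ, true_and] at hh ⊢
  obtain ⟨u, rfl⟩ := ha
  have : (u : ZMod q) * (2 * h) = 0 := by rw [← hh]; ring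
  rw [Units.mul_right_eq_zero] at this
  simpa [two_mul, two_nsmul] using this

/-- Finite Fourier expansion of the quadratic phase. -/
lemma stdAddChar_mul_sq_eq (q : ℕ) [NeZero q] (a n : ZMod q) :
    (ZMod.stdAddChar (a * n ^ 2) : ℂ) =
      1 / q * ∑ j : ZMod q, gaussSum q a j * ZMod.stdAddChar (-(j * n)) := by
  have hq : (q : ℂ) ≠ 0 := Nat.cast_ne_zero.2 (NeZero.ne q)
  simp_rw [gaussSum, Finset.sum_mul, ← AddChar.map_add_eq_mul]
  rw [Finset.sum_comm]
  have : ∀ r : ZMod q, ∑ j : ZMod q, (ZMod.stdAddChar (a * r ^ 2 + j * r + -(j * n)) : ℂ) =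
      ZMod.stdAddChar (a * r ^ 2) * if r - n = 0 then (q : ℂ) else 0 := by
    intro r
    have h := AddChar.sum_mulShift (r - n) (ZMod.isPrimitive_stdAddChar q)
    rw [ZMod.card] at h
    rw [show (if r - n = 0 then (q : ℂ) else 0) = ((if r - n = 0 then q else 0 : ℕ) : ℂ) by
      split_ifs <;> simp, ← h, Finset.mul_sum]
    refine Finset.sum_congr rfl fun j _ => ?_
    rw [← AddChar.map_add_eq_mul]
    congr 1
    ring
  simp_rw [this, sub_eq_zero, mul_ite, mul_zero]
  rw [Finset.sum_ite_eq' Finset.univ n]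
  simp
  field_simp

lemma norm_gaussSum_le (q : ℕ) [NeZero q] {a : ZMod q} (ha : IsUnit a) (j : ZMod q) :
    ‖gaussSum q a j‖ ≤ 2 * √q := by
  refine abs_le_of_sq_le_sq' ?_ (by positivity) |>.2
  rw [mul_pow, Real.sq_sqrt (Nat.cast_nonneg q)]
  have := norm_gaussSum_sq_le q ha j
  have : (0 : ℝ) ≤ q := Nat.cast_nonneg q
  linarith

/-! ### Gaussian-weighted Weyl sums -/

/-- The Gaussian-weighted quadratic Weyl sum `∑ₙ e^{-πsn²} e(nx + n²t)`. -/
def weylSum (s x t : ℝ) : ℂ :=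
  ∑' n : ℤ, ((rexp (-π * s * (n : ℝ) ^ 2) : ℝ) : ℂ) * expi (n * x + (n : ℝ) ^ 2 * t)

lemma expi_rat_mul_sq (q : ℕ) [NeZero q] (a n : ℤ) :
    expi ((n : ℝ) ^ 2 * (a / q)) = ZMod.stdAddChar ((a : ZMod q) * (n : ZMod q) ^ 2) := by
  have := ZMod.stdAddChar_coe (N := q) (a * n ^ 2)
  push_cast at this
  rw [this, expi]
  push_cast
  congr 1
  ring

lemma stdAddChar_neg_mul_int (q : ℕ) [NeZero q] (j : ZMod q) (n : ℤ) :
    (ZMod.stdAddChar (-(j * (n : ZMod q))) : ℂ) = expi (-(j.val / q * n)) := by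
  have := ZMod.stdAddChar_coe (N := q) (-((j.val : ℤ) * n))
  push_cast at this
  rw [ZMod.natCast_zmod_val] at this
  rw [this, expi]
  push_cast
  congr 1
  ring

/-- Poisson summation at the complex parameter z = s - 2iβ, whose positive real part is the Gaussian
damping. -/
lemma tsum_cexp_quadratic (s β y : ℝ) (hs : 0 < s) :
    ∑' n : ℤ, ((rexp (-π * s * (n : ℝ) ^ 2) : ℝ) : ℂ) * expi (n * y + (n : ℝ) ^ 2 * β) =
      1 / ((s : ℂ) - 2 * β * Complex.I) ^ (1 / 2 : ℂ) *
        ∑' n : ℤ, Complex.exp (-π / ((s : ℂ) - 2 * β * Complex.I) * ((n + -y : ℝ) : ℂ) ^ 2) := by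
  have h := Complex.tsum_exp_neg_quadratic (a := (s : ℂ) - 2 * β * Complex.I) (by simpa using hs)
    (Complex.I * y)
  have e1 : ∀ n : ℤ, Complex.I * (Complex.I * (y : ℂ)) = -y := by
    intro n; rw [← mul_assoc, Complex.I_mul_I]; ring
  convert h using 1
  · refine tsum_congr fun n => ?_
    rw [expi, Complex.ofReal_exp, ← Complex.exp_add]
    congr 1
    push_cast
    ring
  · simp only [e1 0]
    push_cast
    rfl

lemma norm_cpow_half (z : ℂ) : ‖z ^ (1 / 2 : ℂ)‖ = √‖z‖ := by
  have h := Complex.cpow_nat_inv_pow z (n := 2) two_ne_zero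
  rw [show (1 / 2 : ℂ) = ((2 : ℕ) : ℂ)⁻¹ by norm_num, eq_comm, Real.sqrt_eq_iff_eq_sq
    (norm_nonneg _) (norm_nonneg _), ← norm_pow, h]

lemma norm_cexp_div (s β u : ℝ) :
    ‖Complex.exp (-π / ((s : ℂ) - 2 * β * Complex.I) * (u : ℂ) ^ 2)‖ =
      rexp (-π * (s / ‖(s : ℂ) - 2 * β * Complex.I‖ ^ 2) * u ^ 2) := by
  set z : ℂ := (s : ℂ) - 2 * β * Complex.I with hz
  rw [Complex.norm_exp]
  congr 1
  have hre : z.re = s := by simp [hz]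
  have : -(π : ℂ) / z * (u : ℂ) ^ 2 = ((-π * u ^ 2 : ℝ) : ℂ) * z⁻¹ := by
    push_cast; ring
  rw [this, Complex.re_ofReal_mul, Complex.inv_re, Complex.normSq_eq_norm_sq, hre]
  ring

/-- The translates of ℤ by j/q, over all residues j, make up (1/q)ℤ, so the q sums form a single
Gaussian sum of parameter ρ/q². Bounding them one by one would give q in place of the 1. -/
lemma sum_tsum_gauss_le (q : ℕ) [NeZero q] {ρ : ℝ} (hρ : 0 < ρ) (x : ℝ) :
    ∑ j : ZMod q, ∑' n : ℤ, rexp (-π * ρ * (n + -(x + -(j.val / q))) ^ 2) ≤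
      gaussConst * (1 + q / √ρ) := by
  have hq : (0 : ℝ) < q := Nat.cast_pos.2 (NeZero.pos q)
  obtain ⟨k, rfl⟩ : ∃ k, q = k + 1 := ⟨q - 1, by have := NeZero.pos q; omega⟩
  have hρ' : 0 < ρ / ((k + 1 : ℕ) : ℝ) ^ 2 := by positivity
  have key := tsum_gauss_le hρ' (-(((k + 1 : ℕ) : ℝ) * x))
  have hsum := summable_gauss hρ' (-(((k + 1 : ℕ) : ℝ) * x))
  have hrw : ∀ p : ℤ × Fin (k + 1),
      rexp (-π * (ρ / ((k + 1 : ℕ) : ℝ) ^ 2) *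
        ((((Int.divModEquiv (k + 1)).symm p : ℤ) : ℝ) + -(((k + 1 : ℕ) : ℝ) * x)) ^ 2) =
      rexp (-π * ρ * (p.1 + -(x + -((p.2 : ℕ) / ((k + 1 : ℕ) : ℝ)))) ^ 2) := by
    rintro ⟨m, j⟩
    rw [Int.divModEquiv_symm_apply]
    congr 1
    push_cast
    field_simp
    ring
  have hs2 := ((Int.divModEquiv (k + 1)).symm.summable_iff.2 hsum)
  rw [← (Int.divModEquiv (k + 1)).symm.tsum_eq] at key
  simp only [Function.comp_def, hrw] at key hs2
  rw [Real.sqrt_div hρ.le, Real.sqrt_sq hq.le, one_div_div] at key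
  refine le_trans (le_of_eq ?_) key
  have hs3 := (Equiv.prodComm _ _).summable_iff.2 hs2
  rw [← (Equiv.prodComm (Fin (k + 1)) ℤ).tsum_eq]
  erw [Summable.tsum_prod hs3]
  rw [tsum_fintype]
  rfl

/-- Weyl sum bound near the rational `a/q`, with `z = s - 2iβ` and `t = a/q + β`. -/
lemma norm_weylSum_le (q : ℕ) [NeZero q] {a : ℤ} (ha : IsUnit (a : ZMod q)) {s : ℝ} (hs : 0 < s)
    (x β : ℝ) :
    ‖weylSum s x (a / q + β)‖ ≤ 2 * gaussConst *
      (1 / √(q * ‖(s : ℂ) - 2 * β * Complex.I‖) +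
        √(q * ‖(s : ℂ) - 2 * β * Complex.I‖) / √s) := by
  set z : ℂ := (s : ℂ) - 2 * β * Complex.I with hz
  have hq : (0 : ℝ) < q := Nat.cast_pos.2 (NeZero.pos q)
  have hzre : z.re = s := by simp [hz]
  have hz0 : z ≠ 0 := by
    intro h
    rw [h] at hzre
    simp at hzre
    linarith
  have hzn : 0 < ‖z‖ := norm_pos_iff.2 hz0
  have hρ : 0 < s / ‖z‖ ^ 2 := by positivity
  have hsumm : ∀ y : ℝ, Summable fun n : ℤ =>
      ((rexp (-π * s * (n : ℝ) ^ 2) : ℝ) : ℂ) * expi (n * y + (n : ℝ) ^ 2 * β) := by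
    intro y
    refine Summable.of_norm ((summable_gauss_zero hs).congr fun n => ?_)
    rw [norm_mul, norm_expi, mul_one, Complex.norm_real, Real.norm_of_nonneg (Real.exp_pos _).le]
  -- The phase e(an²/q) is expanded in additive characters mod q; each j then gives a theta sum
  -- translated by j/q, to which Poisson summation applies.
  have e1 : weylSum s x (a / q + β) = 1 / q * ∑ j : ZMod q, gaussSum q a j *
      (1 / z ^ (1 / 2 : ℂ) *
        ∑' n : ℤ, Complex.exp (-π / z * ((n + -(x + -(j.val / q)) : ℝ) : ℂ) ^ 2)) := by
    simp_rw [hz, ← tsum_cexp_quadratic s β _ hs, ← tsum_mul_left]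
    rw [← Summable.tsum_finsetSum fun j _ => (hsumm _).mul_left _, ← tsum_mul_left, weylSum]
    refine tsum_congr fun n => ?_
    rw [show (n : ℝ) * x + (n : ℝ) ^ 2 * (a / q + β) =
      (n : ℝ) ^ 2 * (a / q) + ((n : ℝ) * x + (n : ℝ) ^ 2 * β) by ring, expi_add,
      expi_rat_mul_sq, stdAddChar_mul_sq_eq]
    simp only [Finset.mul_sum, Finset.sum_mul]
    refine Finset.sum_congr rfl fun j _ => ?_
    rw [stdAddChar_neg_mul_int, show (n : ℝ) * (x + -(j.val / q)) + (n : ℝ) ^ 2 * β =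
      -(j.val / q * n) + ((n : ℝ) * x + (n : ℝ) ^ 2 * β) by ring, expi_add (-(_))]
    ring
  have e2 : ‖weylSum s x (a / q + β)‖ ≤ 1 / q * ∑ j : ZMod q, 2 * √q * (1 / √‖z‖ *
      ∑' n : ℤ, rexp (-π * (s / ‖z‖ ^ 2) * (n + -(x + -(j.val / q))) ^ 2)) := by
    rw [e1, norm_mul, norm_div, norm_one, Complex.norm_natCast]
    gcongr
    refine (norm_sum_le _ _).trans (Finset.sum_le_sum fun j _ => ?_)
    rw [norm_mul, norm_mul, norm_div, norm_one, norm_cpow_half]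
    gcongr
    · exact norm_gaussSum_le q ha j
    · refine tsum_of_norm_bounded (summable_gauss hρ _).hasSum fun n => ?_
      rw [hz, norm_cexp_div]
  refine e2.trans ?_
  rw [← Finset.mul_sum, ← Finset.mul_sum]
  have e3 := sum_tsum_gauss_le q hρ x
  calc _ ≤ 1 / q * (2 * √q * (1 / √‖z‖ * (gaussConst * (1 + q / √(s / ‖z‖ ^ 2))))) := by gcongr
    _ = _ := by
      rw [Real.sqrt_div hs.le, Real.sqrt_sq hzn.le, Real.sqrt_mul hq.le]
      have h1 := Real.mul_self_sqrt hq.le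
      have h2 := Real.mul_self_sqrt hzn.le
      have h3 : 0 < √(q : ℝ) := Real.sqrt_pos.2 hq
      have h4 : 0 < √‖z‖ := Real.sqrt_pos.2 hzn
      have h5 : 0 < √s := Real.sqrt_pos.2 hs
      field_simp
      rw [Real.sq_sqrt hq.le, Real.sq_sqrt hzn.le]

/-- Outside the major arcs of level `Q`, the Weyl sum of length `N` is
`O(N Q^{-1/2} + N^{1/2})`. -/
lemma norm_weylSum_minor (N : ℕ) (hN : 1 ≤ N) (x t : ℝ) {Q : ℕ} (hQ : 1 ≤ Q)
    (ht : ∀ r : ℚ, r.den ≤ Q → (Q : ℝ) / (r.den * N ^ 2) < |t - r|) :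
    ‖weylSum (1 / (N : ℝ) ^ 2) x t‖ ≤ 4 * gaussConst * (N / √Q + √N) := by
  -- Dirichlet approximation with denominators up to N. If the denominator is at most Q, `ht` keeps
  -- t away from r; otherwise the denominator itself is large. Either way `hlow` holds, while
  -- Dirichlet's inequality gives `hup`.
  obtain ⟨r, hr1, hr2⟩ := Real.exists_rat_abs_sub_le_and_den_le t hN
  have hNpos : (0 : ℝ) < N := by positivity
  have : NeZero r.den := ⟨r.den_nz⟩
  have hunit : IsUnit (r.num : ZMod r.den) := by
    rw [ZMod.coe_int_isUnit_iff_isCoprime]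
    exact Int.isCoprime_iff_gcd_eq_one.2 (by simpa [Int.gcd, Nat.Coprime] using r.reduced.symm)
  have hb := norm_weylSum_le r.den hunit (s := 1 / (N : ℝ) ^ 2) (by positivity) x (t - r)
  have hrr : (r.num : ℝ) / (r.den : ℝ) = r := by exact_mod_cast r.num_div_den
  rw [hrr, add_sub_cancel] at hb
  set β := t - (r : ℝ) with hβ
  set z : ℂ := ((1 / (N : ℝ) ^ 2 : ℝ) : ℂ) - 2 * β * Complex.I with hz
  have hq : (1 : ℝ) ≤ r.den := by exact_mod_cast r.den_pos
  have hqN : (r.den : ℝ) ≤ N := by exact_mod_cast hr2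
  have hQ0 : (1 : ℝ) ≤ Q := by exact_mod_cast hQ
  have z1 : 1 / (N : ℝ) ^ 2 ≤ ‖z‖ := by
    have := Complex.abs_re_le_norm z
    have hre : z.re = 1 / (N : ℝ) ^ 2 := by
      rw [hz, Complex.sub_re, Complex.ofReal_re]; simp
    rw [hre] at this
    exact (le_abs_self _).trans this
  have z2 : 2 * |β| ≤ ‖z‖ := by
    have := Complex.abs_im_le_norm z
    have him : z.im = -(2 * β) := by
      rw [hz, Complex.sub_im, Complex.ofReal_im]; simp
    rwa [him, abs_neg, abs_mul, abs_two] at this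
  have z3 : ‖z‖ ≤ 1 / (N : ℝ) ^ 2 + 2 * |β| := by
    refine (norm_sub_le _ _).trans (le_of_eq ?_)
    rw [Complex.norm_real, Real.norm_of_nonneg (by positivity), norm_mul, norm_mul,
      Complex.norm_real, Complex.norm_I, Real.norm_eq_abs]
    simp
  have hlow : (Q : ℝ) / N ^ 2 ≤ r.den * ‖z‖ := by
    by_cases hqQ : r.den ≤ Q
    · have h := ht r hqQ
      rw [div_lt_iff₀ (by positivity)] at h
      rw [div_le_iff₀ (by positivity)]
      have : |β| * (r.den * (N : ℝ) ^ 2) ≤ ‖z‖ * (r.den * (N : ℝ) ^ 2) := by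
        gcongr; linarith [abs_nonneg β]
      nlinarith
    · have h : (Q : ℝ) ≤ r.den := by exact_mod_cast (not_le.1 hqQ).le
      calc (Q : ℝ) / N ^ 2 = Q * (1 / N ^ 2) := by ring
        _ ≤ r.den * ‖z‖ := by gcongr
  have hup : r.den * ‖z‖ ≤ 4 / N := by
    have h1 : |β| ≤ 1 / (N * r.den) := hr1.trans (by gcongr; linarith)
    calc r.den * ‖z‖ ≤ r.den * (1 / (N : ℝ) ^ 2 + 2 * (1 / (N * r.den))) := by
          gcongr; linarith
      _ = r.den / (N : ℝ) ^ 2 + 2 / N := by field_simp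
      _ ≤ N / (N : ℝ) ^ 2 + 2 / N := by gcongr
      _ = 3 / N := by field_simp; norm_num
      _ ≤ 4 / N := by gcongr; norm_num
  refine hb.trans ?_
  have hg := one_le_gaussConst
  have b1 : 1 / √(r.den * ‖z‖) ≤ N / √Q := by
    have : √((Q : ℝ) / N ^ 2) = √Q / N := by
      rw [Real.sqrt_div (by positivity), Real.sqrt_sq hNpos.le]
    rw [← one_div_div (√(Q : ℝ)) (N : ℝ), ← this]
    have : 0 < √((Q : ℝ) / N ^ 2) := Real.sqrt_pos.2 (by positivity)
    gcongr
  have b2 : √(r.den * ‖z‖) / √(1 / (N : ℝ) ^ 2) ≤ 2 * √N := by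
    have h1 : √(1 / (N : ℝ) ^ 2) = 1 / N := by
      rw [Real.sqrt_div (by positivity), Real.sqrt_sq hNpos.le, Real.sqrt_one]
    have h2 : √(r.den * ‖z‖) ≤ 2 / √N := by
      refine (Real.sqrt_le_sqrt hup).trans (le_of_eq ?_)
      rw [Real.sqrt_div (by norm_num), show (4 : ℝ) = 2 ^ 2 by norm_num,
        Real.sqrt_sq (by norm_num)]
    rw [h1, div_div_eq_mul_div, div_one]
    calc √(r.den * ‖z‖) * N ≤ 2 / √N * N := by gcongr
      _ = 2 * √N := by
        have h3 : 0 < √(N : ℝ) := Real.sqrt_pos.2 hNpos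
        field_simp
        rw [Real.sq_sqrt hNpos.le]
  have b3 : 0 ≤ (N : ℝ) / √Q := by positivity
  calc _ ≤ 2 * gaussConst * (N / √Q + 2 * √N) := by gcongr
    _ ≤ _ := by nlinarith [mul_nonneg (zero_le_one.trans hg) b3]

/-! ### The divisor bound -/

/-- The factor of a single prime in the divisor bound. Its constant is paid only for primes below
about 2^{1/δ}; larger primes need none. -/
lemma natCast_add_one_le_rpow {δ : ℝ} (hδ : 0 < δ) (e : ℕ) :
    (e : ℝ) + 1 ≤ (1 + 1 / (δ * Real.log 2)) * (2 : ℝ) ^ (δ * e) := by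
  have hl : 0 < Real.log 2 := Real.log_pos one_lt_two
  have h1 : 1 + δ * Real.log 2 * e ≤ (2 : ℝ) ^ (δ * e) := by
    rw [Real.rpow_def_of_pos two_pos]
    have := Real.add_one_le_exp (Real.log 2 * (δ * e))
    linarith
  have h2 : (e : ℝ) + 1 ≤ (1 + 1 / (δ * Real.log 2)) * (1 + δ * Real.log 2 * e) := by
    have : (1 + 1 / (δ * Real.log 2)) * (1 + δ * Real.log 2 * e) =
      1 + e + (1 / (δ * Real.log 2) + δ * Real.log 2 * e) := by field_simp; ring
    rw [this]
    have : 0 ≤ 1 / (δ * Real.log 2) + δ * Real.log 2 * e := by positivity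
    linarith
  exact h2.trans (by gcongr)

/-- The divisor bound `d(n) ≤ C n^δ`. -/
lemma exists_card_divisors_le {δ : ℝ} (hδ : 0 < δ) :
    ∃ C : ℝ, 1 ≤ C ∧ ∀ n : ℕ, n ≠ 0 → (n.divisors.card : ℝ) ≤ C * (n : ℝ) ^ δ := by
  set K : ℝ := 1 + 1 / (δ * Real.log 2) with hK
  have hl : 0 < Real.log 2 := Real.log_pos one_lt_two
  have hK1 : 1 ≤ K := by rw [hK]; have : 0 ≤ 1 / (δ * Real.log 2) := by positivity
                         linarith
  set P : ℕ := ⌈(2 : ℝ) ^ (1 / δ)⌉₊ with hP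
  refine ⟨K ^ P, one_le_pow₀ hK1, fun n hn => ?_⟩
  rw [Nat.card_divisors hn]
  have hn' : (n : ℝ) ^ δ = ∏ p ∈ n.primeFactors, ((p : ℝ) ^ (δ * n.factorization p)) := by
    conv_lhs => rw [← Nat.prod_factorization_pow_eq_self hn]
    rw [Finsupp.prod, Nat.support_factorization, Nat.cast_prod,
      ← Real.finsetProd_rpow _ _ fun i _ => Nat.cast_nonneg _]
    refine Finset.prod_congr rfl fun p _ => ?_
    rw [Nat.cast_pow, ← Real.rpow_natCast, ← Real.rpow_mul (Nat.cast_nonneg p), mul_comm]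
  have hKP : ∏ p ∈ n.primeFactors, (if p < P then K else 1) ≤ K ^ P := by
    rw [← Finset.prod_filter, Finset.prod_const]
    refine pow_le_pow_right₀ hK1 ?_
    calc _ ≤ (Finset.range P).card := Finset.card_le_card fun p hp => by
            simp only [Finset.mem_filter, Finset.mem_range] at hp ⊢; exact hp.2
      _ = P := Finset.card_range P
  calc ((∏ p ∈ n.primeFactors, (n.factorization p + 1) : ℕ) : ℝ)
      = ∏ p ∈ n.primeFactors, ((n.factorization p : ℝ) + 1) := by push_cast; rfl
    _ ≤ ∏ p ∈ n.primeFactors, ((if p < P then K else 1) * (p : ℝ) ^ (δ * n.factorization p)) := by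
        refine Finset.prod_le_prod (fun p _ => by positivity) fun p hp => ?_
        have hp2 : 2 ≤ p := (Nat.prime_of_mem_primeFactors hp).two_le
        have hp2' : (2 : ℝ) ≤ p := by exact_mod_cast hp2
        split_ifs with h
        · refine (natCast_add_one_le_rpow hδ _).trans ?_
          gcongr
        · rw [one_mul, Real.rpow_mul (by positivity)]
          have h1 : (2 : ℝ) ≤ (p : ℝ) ^ δ := by
            have : (2 : ℝ) ^ (1 / δ) ≤ p := (Nat.le_ceil _).trans (by exact_mod_cast not_lt.1 h)
            calc (2 : ℝ) = ((2 : ℝ) ^ (1 / δ)) ^ δ := by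
                  rw [← Real.rpow_mul (by norm_num), one_div_mul_cancel hδ.ne', Real.rpow_one]
              _ ≤ _ := by gcongr
          rw [Real.rpow_natCast]
          calc ((n.factorization p : ℝ) + 1) ≤ 2 ^ n.factorization p := by
                exact_mod_cast Nat.lt_two_pow_self
            _ ≤ _ := by gcongr
    _ = (∏ p ∈ n.primeFactors, (if p < P then K else 1)) * (n : ℝ) ^ δ := by
        rw [Finset.prod_mul_distrib, hn']
    _ ≤ _ := by gcongr

lemma harmonic_sum_le (Q : ℕ) : ∑ r ∈ Finset.Icc 1 Q, 1 / (r : ℝ) ≤ 1 + Real.log Q := by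
  have := harmonic_le_one_add_log Q
  rw [harmonic_eq_sum_Icc] at this
  push_cast at this
  simpa using this

lemma one_add_log_le_rpow {δ : ℝ} (hδ : 0 < δ) {Q : ℕ} (hQ : 1 ≤ Q) :
    1 + Real.log Q ≤ (1 + 1 / δ) * (Q : ℝ) ^ δ := by
  have h1 : (1 : ℝ) ≤ Q := by exact_mod_cast hQ
  have h2 := Real.log_le_rpow_div (x := Q) (by positivity) hδ
  have h3 : (1 : ℝ) ≤ (Q : ℝ) ^ δ := Real.one_le_rpow h1 hδ.le
  calc _ ≤ (Q : ℝ) ^ δ + (Q : ℝ) ^ δ / δ := by linarith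
    _ = _ := by ring

/-- Averages of reciprocals of least common multiples grow slower than any power. -/
lemma exists_sum_one_div_lcm_le (s : ℕ) {δ : ℝ} (hδ : 0 < δ) :
    ∃ C : ℝ, 0 < C ∧ ∀ Q : ℕ, 1 ≤ Q →
      ∑ v ∈ Fintype.piFinset fun _ : Fin s => Finset.Icc 1 Q, 1 / ((Finset.univ.lcm v : ℕ) : ℝ) ≤
        C * (Q : ℝ) ^ δ := by
  -- Chosen so that s²η + sη ≤ δ: the first part comes from s divisor bounds at integers up to Q^s,
  -- the second from the harmonic sum up to Q^s.
  set η : ℝ := δ / (2 * (s + 1) ^ 2) with hη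
  have hη0 : 0 < η := by positivity
  obtain ⟨D, hD1, hD⟩ := exists_card_divisors_le hη0
  refine ⟨D ^ s * (1 + 1 / η), by positivity, fun Q hQ => ?_⟩
  have hQ1 : (1 : ℝ) ≤ Q := by exact_mod_cast hQ
  have hmaps : ∀ v ∈ Fintype.piFinset fun _ : Fin s => Finset.Icc 1 Q,
      Finset.univ.lcm v ∈ Finset.Icc 1 (Q ^ s) := by
    intro v hv
    simp only [Fintype.mem_piFinset, Finset.mem_Icc] at hv ⊢
    have h1 : Finset.univ.lcm v ∣ ∏ i, v i :=
      Finset.lcm_dvd fun i _ => Finset.dvd_prod_of_mem v (Finset.mem_univ i)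
    have h2 : 0 < ∏ i, v i := Finset.prod_pos fun i _ => (hv i).1
    refine ⟨Nat.pos_of_dvd_of_pos h1 h2, (Nat.le_of_dvd h2 h1).trans ?_⟩
    calc ∏ i, v i ≤ ∏ _i : Fin s, Q := Finset.prod_le_prod' fun i _ => (hv i).2
      _ = Q ^ s := by simp
  rw [← Finset.sum_fiberwise_of_maps_to hmaps]
  -- A tuple with least common multiple L consists of divisors of L, so the fibre over L has at most
  -- d(L)^s elements.
  have hfib : ∀ L ∈ Finset.Icc 1 (Q ^ s),
      ∑ v ∈ Fintype.piFinset (fun _ : Fin s => Finset.Icc 1 Q) with Finset.univ.lcm v = L,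
        1 / ((Finset.univ.lcm v : ℕ) : ℝ) ≤ (D * ((Q : ℝ) ^ s) ^ η) ^ s * (1 / (L : ℝ)) := by
    intro L hL
    rw [Finset.mem_Icc] at hL
    rw [Finset.sum_congr rfl (g := fun _ => 1 / (L : ℝ)) (fun v hv => by
      rw [(Finset.mem_filter.1 hv).2]), Finset.sum_const, nsmul_eq_mul]
    gcongr
    have hcard : (((Fintype.piFinset fun _ : Fin s => Finset.Icc 1 Q).filter
        fun v => Finset.univ.lcm v = L).card : ℝ) ≤ (L.divisors.card : ℝ) ^ s := by
      rw [← Nat.cast_pow]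
      refine Nat.cast_le.2 ?_
      calc _ ≤ (Fintype.piFinset fun _ : Fin s => L.divisors).card := by
            refine Finset.card_le_card fun v hv => ?_
            rw [Finset.mem_filter] at hv
            rw [Fintype.mem_piFinset]
            intro i
            rw [Nat.mem_divisors]
            exact ⟨hv.2 ▸ Finset.dvd_lcm (Finset.mem_univ i), by omega⟩
        _ = _ := by simp
    refine hcard.trans ?_
    gcongr
    refine (hD L (by omega)).trans ?_
    gcongr
    exact_mod_cast hL.2
  refine (Finset.sum_le_sum hfib).trans ?_
  rw [← Finset.mul_sum]
  have hlog := (harmonic_sum_le (Q ^ s)).trans (one_add_log_le_rpow hη0 (Nat.one_le_pow _ _ hQ))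
  calc _ ≤ (D * ((Q : ℝ) ^ s) ^ η) ^ s * ((1 + 1 / η) * ((Q ^ s : ℕ) : ℝ) ^ η) := by gcongr
    _ = D ^ s * (1 + 1 / η) * (Q : ℝ) ^ ((s : ℝ) * η * s + s * η) := by
        push_cast
        rw [Real.rpow_add (by positivity), Real.rpow_mul (by positivity),
          Real.rpow_mul (by positivity), Real.rpow_natCast, Real.rpow_natCast]
        ring
    _ ≤ _ := by
        gcongr
        · rw [hη]
          have : (s : ℝ) * (δ / (2 * (s + 1) ^ 2)) * s + s * (δ / (2 * (s + 1) ^ 2)) =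
            δ * ((s * s + s) / (2 * (s + 1) ^ 2)) := by ring
          rw [this]
          refine mul_le_of_le_one_right hδ.le ?_
          rw [div_le_one (by positivity)]
          have : (0 : ℝ) ≤ s := Nat.cast_nonneg s
          nlinarith

/-! ### Moments of restricted divisor functions -/

/-- The number of divisors of `k` that are at most `Q`. -/
def divCount (Q k : ℕ) : ℕ := ((Finset.Icc 1 Q).filter (· ∣ k)).card

/-- A telescoping majorant: the increments of -4Y²/(Y + K) dominate the terms both for j below Y and
for j above Y. -/
lemma sum_min_sq_le {Y : ℝ} (hY : 0 < Y) (K : ℕ) :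
    ∑ j ∈ Finset.Icc 1 K, min 1 ((Y / (j : ℝ)) ^ 2) ≤ 4 * Y := by
  suffices h : ∑ j ∈ Finset.Icc 1 K, min 1 ((Y / (j : ℝ)) ^ 2) ≤ 4 * Y - 4 * Y ^ 2 / (Y + K) by
    have : 0 ≤ 4 * Y ^ 2 / (Y + K) := by positivity
    linarith
  induction K with
  | zero => simp; field_simp; simp
  | succ K ih =>
    rw [Finset.sum_Icc_succ_top (by omega)]
    have h1 : (0 : ℝ) ≤ K := Nat.cast_nonneg K
    have key : min 1 ((Y / ((K + 1 : ℕ) : ℝ)) ^ 2) ≤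
        4 * Y ^ 2 / (Y + K) - 4 * Y ^ 2 / (Y + (K + 1 : ℕ)) := by
      push_cast
      have e : 4 * Y ^ 2 / (Y + K) - 4 * Y ^ 2 / (Y + (K + 1)) =
          4 * Y ^ 2 / ((Y + K) * (Y + (K + 1))) := by field_simp; ring
      rw [e]
      rcases le_total Y (K + 1) with h | h
      · refine (min_le_right _ _).trans ?_
        rw [div_pow, div_le_div_iff₀ (by positivity) (by positivity)]
        have : (Y + K) * (Y + (K + 1)) ≤ 4 * (K + 1) ^ 2 := by nlinarith
        nlinarith [sq_nonneg Y]
      · refine (min_le_left _ _).trans ?_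
        rw [le_div_iff₀ (by positivity)]
        nlinarith
    linarith

lemma sum_min_sq_dvd_le {X : ℝ} (hX : 0 < X) {L : ℕ} (hL : 0 < L) (K : ℕ) :
    ∑ k ∈ Finset.Icc 1 K with L ∣ k, min 1 ((X / (k : ℝ)) ^ 2) ≤ 4 * X * (1 / (L : ℝ)) := by
  have hL' : (0 : ℝ) < L := by exact_mod_cast hL
  have h := sum_min_sq_le (Y := X / L) (by positivity) K
  calc _ ≤ ∑ k ∈ (Finset.Icc 1 K).image (L * ·), min 1 ((X / (k : ℝ)) ^ 2) := by
        refine Finset.sum_le_sum_of_subset_of_nonneg ?_ fun _ _ _ => by positivity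
        intro k hk
        rw [Finset.mem_filter, Finset.mem_Icc] at hk
        obtain ⟨⟨h1, h2⟩, j, rfl⟩ := hk
        refine Finset.mem_image.2 ⟨j, Finset.mem_Icc.2 ⟨?_, ?_⟩, rfl⟩
        · exact Nat.pos_of_mul_pos_left (by omega : 0 < L * j)
        · exact (Nat.le_mul_of_pos_left j hL).trans h2
    _ = ∑ j ∈ Finset.Icc 1 K, min 1 ((X / L / (j : ℝ)) ^ 2) := by
        rw [Finset.sum_image fun a _ b _ hab => Nat.eq_of_mul_eq_mul_left hL hab]
        push_cast
        simp_rw [div_div]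
    _ ≤ 4 * (X / L) := h
    _ = _ := by ring

/-- The power counts s-tuples of divisors, and all entries divide k exactly when their least common
multiple does. This reduces moments to averages of reciprocals of least common multiples. -/
lemma divCount_pow_eq (Q k s : ℕ) : ((divCount Q k : ℝ)) ^ s =
    ∑ v ∈ Fintype.piFinset fun _ : Fin s => Finset.Icc 1 Q,
      if Finset.univ.lcm v ∣ k then (1 : ℝ) else 0 := by
  have h : (Fintype.piFinset fun _ : Fin s => Finset.Icc 1 Q).filter
      (fun v => Finset.univ.lcm v ∣ k) =
      Fintype.piFinset fun _ : Fin s => (Finset.Icc 1 Q).filter (· ∣ k) := by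
    ext v
    simp only [Fintype.mem_piFinset, Finset.mem_filter, Finset.lcm_dvd_iff, Finset.mem_univ,
      true_implies]
    exact forall_and.symm
  rw [← Finset.sum_filter, Finset.sum_const, nsmul_eq_mul, mul_one, h, divCount]
  simp

/-- Moment bound for the restricted divisor function with a weight of size `X`. -/
lemma exists_sum_divCount_pow_le (s : ℕ) {δ : ℝ} (hδ : 0 < δ) :
    ∃ C : ℝ, 0 < C ∧ ∀ Q : ℕ, 1 ≤ Q → ∀ X : ℝ, 0 < X → ∀ F : Finset ℤ, 0 ∉ F →
      ∑ k ∈ F, min 1 ((X / (k : ℝ)) ^ 2) * (divCount Q k.natAbs : ℝ) ^ s ≤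
        C * (Q : ℝ) ^ δ * X := by
  obtain ⟨C, hC, h⟩ := exists_sum_one_div_lcm_le s hδ
  refine ⟨8 * C, by positivity, fun Q hQ X hX F hF => ?_⟩
  have nat : ∀ K : ℕ, ∑ k ∈ Finset.Icc 1 K, min 1 ((X / (k : ℝ)) ^ 2) * (divCount Q k : ℝ) ^ s ≤
      4 * X * (C * (Q : ℝ) ^ δ) := by
    intro K
    simp_rw [divCount_pow_eq, Finset.mul_sum]
    rw [Finset.sum_comm]
    calc _ ≤ ∑ v ∈ Fintype.piFinset fun _ : Fin s => Finset.Icc 1 Q,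
          4 * X * (1 / ((Finset.univ.lcm v : ℕ) : ℝ)) := by
          refine Finset.sum_le_sum fun v hv => ?_
          simp_rw [mul_ite, mul_one, mul_zero]
          rw [← Finset.sum_filter]
          refine sum_min_sq_dvd_le hX (Nat.pos_of_ne_zero ?_) K
          rw [Ne, Finset.lcm_eq_zero_iff]
          rw [Fintype.mem_piFinset] at hv
          rintro ⟨i, -, hi⟩
          have := Finset.mem_Icc.1 (hv i)
          omega
      _ ≤ _ := by rw [← Finset.mul_sum]; gcongr; exact h Q hQ
  set g : ℕ → ℝ := fun k => min 1 ((X / (k : ℝ)) ^ 2) * (divCount Q k : ℝ) ^ s with hg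
  have hg0 : ∀ k, 0 ≤ g k := fun k => by positivity
  have hgk : ∀ k : ℤ, min 1 ((X / (k : ℝ)) ^ 2) * (divCount Q k.natAbs : ℝ) ^ s = g k.natAbs := by
    intro k
    rw [hg]
    simp only
    rw [div_pow, div_pow, Nat.cast_natAbs, Int.cast_abs, sq_abs]
  simp_rw [hgk]
  set K := F.sup Int.natAbs
  have half : ∀ G ⊆ F, Set.InjOn Int.natAbs (G : Set ℤ) →
      ∑ k ∈ G, g k.natAbs ≤ 4 * X * (C * (Q : ℝ) ^ δ) := by
    intro G hG hinj
    rw [← Finset.sum_image (f := g) hinj]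
    refine le_trans (Finset.sum_le_sum_of_subset_of_nonneg ?_ fun k _ _ => hg0 k) (nat K)
    intro m hm
    obtain ⟨k, hk, rfl⟩ := Finset.mem_image.1 hm
    have : k ≠ 0 := fun h0 => hF (h0 ▸ hG hk)
    exact Finset.mem_Icc.2 ⟨Int.natAbs_pos.2 this, Finset.le_sup (f := Int.natAbs) (hG hk)⟩
  rw [← Finset.sum_filter_add_sum_filter_not F (fun k => 0 < k)]
  have a1 := half (F.filter fun k => 0 < k) (Finset.filter_subset _ _) (by
    intro a ha b hb hab
    simp only [Finset.coe_filter, Set.mem_ofPred_eq] at ha hb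
    omega)
  have a2 := half (F.filter fun k => ¬ 0 < k) (Finset.filter_subset _ _) (by
    intro a ha b hb hab
    simp only [Finset.coe_filter, Set.mem_ofPred_eq] at ha hb
    omega)
  linarith

/-! ### Ramanujan sums -/

/-- The Ramanujan sum `∑_{a mod q, (a,q)=1} e(-ka/q)`. -/
def ramanujanSum (q : ℕ) (k : ℤ) : ℂ :=
  ∑ a ∈ Finset.range q with Nat.Coprime a q, expi (-(k * (a / q)))

lemma norm_sum_expi_le {m : ℕ} (hm : 0 < m) (k : ℤ) :
    ‖∑ b ∈ Finset.range m, expi (-(k * (b / m)))‖ ≤ if m ∣ k.natAbs then (m : ℝ) else 0 := by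
  have hm' : (m : ℝ) ≠ 0 := by positivity
  split_ifs with h
  · refine (norm_sum_le _ _).trans ?_
    simp [norm_expi]
  · have hpow : ∀ b : ℕ, expi (-(k * (b / m))) = expi (-(k / m)) ^ b := by
      intro b
      rw [expi, expi, ← Complex.exp_nat_mul]
      push_cast
      congr 1
      ring
    have h1 : expi (-(k / m)) ^ m = 1 := by
      rw [← hpow, div_self hm', mul_one, ← Int.cast_neg]
      exact expi_int _
    have h2 : expi (-((k : ℝ) / m)) ≠ 1 := by
      intro h3
      rw [expi, Complex.exp_eq_one_iff] at h3
      obtain ⟨n, hn⟩ := h3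
      have h4 : (((-(k / m) : ℝ)) : ℂ) = ((n : ℝ) : ℂ) := by
        have : (2 * π * Complex.I : ℂ) ≠ 0 := Complex.two_pi_I_ne_zero
        apply mul_left_cancel₀ this
        rw [hn]; push_cast; ring
      rw [Complex.ofReal_inj] at h4
      apply h
      rw [← Int.natCast_dvd]
      refine ⟨-n, ?_⟩
      have : (k : ℝ) = m * (-n) := by rw [← h4]; field_simp
      exact_mod_cast this
    simp_rw [hpow]
    rw [geom_sum_eq h2, h1, sub_self, zero_div, norm_zero]

lemma sum_moebius_divisors_gcd {a q : ℕ} (hq : 0 < q) :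
    ∑ e ∈ q.divisors with e ∣ a, (ArithmeticFunction.moebius e : ℂ) =
      if Nat.Coprime a q then 1 else 0 := by
  have h1 : q.divisors.filter (· ∣ a) = (Nat.gcd a q).divisors := by
    ext e
    have : Nat.gcd a q ≠ 0 := (Nat.gcd_pos_of_pos_right _ hq).ne'
    have hq0 := hq.ne'
    simp only [Finset.mem_filter, Nat.mem_divisors, Nat.dvd_gcd_iff]
    tauto
  have h2 := congrArg (fun f => f (Nat.gcd a q)) ArithmeticFunction.moebius_mul_coe_zeta
  simp only [ArithmeticFunction.coe_mul_zeta_apply, ArithmeticFunction.one_apply] at h2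
  rw [h1, ← Int.cast_sum, h2]
  simp only [Nat.Coprime]
  split_ifs <;> simp

/-- `|c_q(k)| ≤ ∑_{d ∣ (q, k)} d`. -/
lemma norm_ramanujanSum_le {q : ℕ} (hq : 0 < q) (k : ℤ) :
    ‖ramanujanSum q k‖ ≤ ∑ d ∈ q.divisors with d ∣ k.natAbs, (d : ℝ) := by
  have e1 : ramanujanSum q k = ∑ e ∈ q.divisors, (ArithmeticFunction.moebius e : ℂ) *
      ∑ b ∈ Finset.range (q / e), expi (-(k * (b / (q / e : ℕ)))) := by
    rw [ramanujanSum, Finset.sum_filter]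
    have : ∀ a ∈ Finset.range q, (if Nat.Coprime a q then expi (-(k * (a / q))) else 0) =
        ∑ e ∈ q.divisors, if e ∣ a then
          (ArithmeticFunction.moebius e : ℂ) * expi (-(k * (a / q))) else 0 := by
      intro a _
      rw [← Finset.sum_filter, ← Finset.sum_mul, sum_moebius_divisors_gcd hq]
      split_ifs <;> simp
    rw [Finset.sum_congr rfl this, Finset.sum_comm]
    refine Finset.sum_congr rfl fun e he => ?_
    obtain ⟨⟨m, rfl⟩, -⟩ := Nat.mem_divisors.1 he
    have he0 : 0 < e := Nat.pos_of_mul_pos_right hq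
    rw [← Finset.sum_filter, Nat.mul_div_cancel_left m he0, Finset.mul_sum]
    have himg : (Finset.range (e * m)).filter (e ∣ ·) = (Finset.range m).image (e * ·) := by
      ext a
      simp only [Finset.mem_filter, Finset.mem_range, Finset.mem_image]
      constructor
      · rintro ⟨h1, j, rfl⟩
        exact ⟨j, lt_of_mul_lt_mul_left' h1, rfl⟩
      · rintro ⟨j, hj, rfl⟩
        exact ⟨Nat.mul_lt_mul_of_pos_left hj he0, Dvd.intro _ rfl⟩
    rw [himg, Finset.sum_image fun a _ b _ hab => Nat.eq_of_mul_eq_mul_left he0 hab]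
    refine Finset.sum_congr rfl fun b _ => ?_
    push_cast
    have : (e : ℝ) ≠ 0 := by positivity
    rw [mul_div_mul_left _ _ this]
  rw [e1]
  calc _ ≤ ∑ e ∈ q.divisors, if q / e ∣ k.natAbs then ((q / e : ℕ) : ℝ) else 0 := by
        refine (norm_sum_le _ _).trans (Finset.sum_le_sum fun e he => ?_)
        rw [norm_mul]
        have h1 : ‖(ArithmeticFunction.moebius e : ℂ)‖ ≤ 1 := by
          rw [Complex.norm_intCast]
          exact_mod_cast ArithmeticFunction.abs_moebius_le_one
        have h2 := norm_sum_expi_le (Nat.div_pos (Nat.divisor_le he)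
          (Nat.pos_of_mem_divisors he)) k
        calc _ ≤ 1 * _ := mul_le_mul h1 h2 (norm_nonneg _) zero_le_one
          _ = _ := one_mul _
    _ = ∑ d ∈ q.divisors, if d ∣ k.natAbs then (d : ℝ) else 0 :=
        Nat.sum_div_divisors q fun d => if d ∣ k.natAbs then (d : ℝ) else 0
    _ = _ := by rw [Finset.sum_filter]

/-- After exchanging sums, each common divisor d collects d/q over its multiples q ≤ Q, which is a
harmonic sum. Only divisors of k up to Q occur, so the bound involves no power of k by itself. -/
lemma sum_norm_ramanujanSum_div_le (Q : ℕ) (k : ℤ) :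
    ∑ q ∈ Finset.Icc 1 Q, 1 / (q : ℝ) * ‖ramanujanSum q k‖ ≤
      (1 + Real.log Q) * divCount Q k.natAbs := by
  calc _ ≤ ∑ q ∈ Finset.Icc 1 Q, ∑ d ∈ Finset.Icc 1 Q with d ∣ k.natAbs,
        if d ∣ q then (d : ℝ) / q else 0 := by
        refine Finset.sum_le_sum fun q hq => ?_
        rw [Finset.mem_Icc] at hq
        have := norm_ramanujanSum_le (q := q) (by omega) k
        rw [← Finset.sum_filter, Finset.filter_filter]
        calc _ ≤ 1 / (q : ℝ) * ∑ d ∈ q.divisors with d ∣ k.natAbs, (d : ℝ) := by gcongr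
          _ = ∑ d ∈ q.divisors with d ∣ k.natAbs, (d : ℝ) / q := by
            rw [Finset.mul_sum]
            exact Finset.sum_congr rfl fun _ _ => by ring
          _ ≤ _ := by
            refine Finset.sum_le_sum_of_subset_of_nonneg ?_ fun _ _ _ => by positivity
            intro d hd
            simp only [Finset.mem_filter, Nat.mem_divisors, Finset.mem_Icc] at hd ⊢
            have h1 := Nat.le_of_dvd (by omega) hd.1.1
            have h2 := Nat.pos_of_dvd_of_pos hd.1.1 (by omega)
            exact ⟨⟨h2, by omega⟩, hd.2, hd.1.1⟩
    _ = ∑ d ∈ Finset.Icc 1 Q with d ∣ k.natAbs, ∑ q ∈ Finset.Icc 1 Q with d ∣ q, (d : ℝ) / q := by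
        rw [Finset.sum_comm]
        simp_rw [Finset.sum_filter]
    _ ≤ ∑ d ∈ Finset.Icc 1 Q with d ∣ k.natAbs, (1 + Real.log Q) := by
        refine Finset.sum_le_sum fun d hd => ?_
        have hd0 : 0 < d := (Finset.mem_Icc.1 (Finset.mem_filter.1 hd).1).1
        have hd1 : (d : ℝ) ≠ 0 := by positivity
        calc _ ≤ ∑ q ∈ (Finset.Icc 1 Q).image (d * ·), (d : ℝ) / q := by
              refine Finset.sum_le_sum_of_subset_of_nonneg ?_ fun _ _ _ => by positivity
              intro q hq
              rw [Finset.mem_filter, Finset.mem_Icc] at hq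
              obtain ⟨⟨h1, h2⟩, j, rfl⟩ := hq
              refine Finset.mem_image.2 ⟨j, Finset.mem_Icc.2 ⟨?_, ?_⟩, rfl⟩
              · exact Nat.pos_of_mul_pos_left (by omega : 0 < d * j)
              · exact (Nat.le_mul_of_pos_left j hd0).trans h2
          _ = ∑ r ∈ Finset.Icc 1 Q, 1 / (r : ℝ) := by
              rw [Finset.sum_image fun a _ b _ hab => Nat.eq_of_mul_eq_mul_left hd0 hab]
              refine Finset.sum_congr rfl fun r _ => ?_
              push_cast
              rw [div_mul_eq_div_div, div_self hd1]
          _ ≤ _ := harmonic_sum_le Q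
    _ = _ := by rw [Finset.sum_const, nsmul_eq_mul, divCount, mul_comm]

/-! ### Periodic trapezoids -/

/-- The trapezoid equal to `1` on `[-T, T]` and to `0` off `[-2T, 2T]`. -/
def trapezoid (T u : ℝ) : ℝ := (|u - 2 * T| + |u + 2 * T| - |u - T| - |u + T|) / (2 * T)

/-- The Fourier coefficients of the `1`-periodic extension of `trapezoid T`. -/
def trapezoidCoeff (T : ℝ) (k : ℤ) : ℝ :=
  if k = 0 then 3 * T else
    -(Real.cos (4 * π * k * T) - Real.cos (2 * π * k * T)) / (2 * T * π ^ 2 * (k : ℝ) ^ 2)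

lemma trapezoid_nonneg {T : ℝ} (hT : 0 < T) (u : ℝ) : 0 ≤ trapezoid T u := by
  unfold trapezoid
  apply div_nonneg _ (by linarith)
  rcases abs_cases (u - 2 * T) with h1 | h1 <;> rcases abs_cases (u + 2 * T) with h2 | h2 <;>
    rcases abs_cases (u - T) with h3 | h3 <;> rcases abs_cases (u + T) with h4 | h4 <;> linarith

lemma trapezoid_le_one {T : ℝ} (hT : 0 < T) (u : ℝ) : trapezoid T u ≤ 1 := by
  unfold trapezoid
  rw [div_le_one (by linarith)]
  rcases abs_cases (u - 2 * T) with h1 | h1 <;> rcases abs_cases (u + 2 * T) with h2 | h2 <;>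
    rcases abs_cases (u - T) with h3 | h3 <;> rcases abs_cases (u + T) with h4 | h4 <;> linarith

lemma trapezoid_eq_one {T u : ℝ} (hT : 0 < T) (hu : |u| ≤ T) : trapezoid T u = 1 := by
  obtain ⟨h1, h2⟩ := abs_le.1 hu
  rw [trapezoid, abs_of_nonpos (by linarith), abs_of_nonneg (by linarith),
    abs_of_nonpos (by linarith), abs_of_nonneg (by linarith), div_eq_one_iff_eq (by linarith)]
  ring

lemma trapezoid_eq_zero {T u : ℝ} (hT : 0 < T) (hu : 2 * T ≤ |u|) : trapezoid T u = 0 := by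
  rw [trapezoid, div_eq_zero_iff]
  left
  rcases le_abs.1 hu with h | h
  · rw [abs_of_nonneg (by linarith), abs_of_nonneg (by linarith), abs_of_nonneg (by linarith),
      abs_of_nonneg (by linarith)]
    ring
  · rw [abs_of_nonpos (by linarith), abs_of_nonpos (by linarith), abs_of_nonpos (by linarith),
      abs_of_nonpos (by linarith)]
    ring

lemma abs_trapezoidCoeff_le {T : ℝ} (hT : 0 < T) (k : ℤ) : |trapezoidCoeff T k| ≤ 3 * T := by
  unfold trapezoidCoeff
  split_ifs with hk
  · rw [abs_of_pos (by linarith)]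
  · have hk' : (k : ℝ) ≠ 0 := Int.cast_ne_zero.2 hk
    have hk2 : 0 < (k : ℝ) ^ 2 := by positivity
    have hc : 0 < 2 * T * π ^ 2 * (k : ℝ) ^ 2 := by positivity
    rw [abs_div, abs_neg, abs_of_pos hc, div_le_iff₀ hc, Real.cos_sub_cos, abs_mul, abs_mul]
    have h1 := Real.abs_sin_le_abs (x := (4 * π * k * T + 2 * π * k * T) / 2)
    have h2 := Real.abs_sin_le_abs (x := (4 * π * k * T - 2 * π * k * T) / 2)
    rw [show |(-2 : ℝ)| = 2 by norm_num]
    calc _ ≤ 2 * |(4 * π * k * T + 2 * π * k * T) / 2| * |(4 * π * k * T - 2 * π * k * T) / 2| := by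
          gcongr
      _ = 2 * |3 * (π * k * T) * (π * k * T)| := by rw [mul_assoc, ← abs_mul]; ring_nf
      _ = _ := by rw [abs_of_nonneg (by nlinarith [sq_nonneg (π * k * T)])]; ring

/-- The quadratic decay is the gain from sloping sides: it makes the coefficients absolutely
summable, unlike those of a sharp cutoff. -/
lemma abs_trapezoidCoeff_le_div {T : ℝ} (hT : 0 < T) {k : ℤ} (hk : k ≠ 0) :
    |trapezoidCoeff T k| ≤ 1 / (T * (k : ℝ) ^ 2) := by
  rw [trapezoidCoeff, if_neg hk]
  have hk' : (k : ℝ) ≠ 0 := Int.cast_ne_zero.2 hk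
  have hk2 : 0 < (k : ℝ) ^ 2 := by positivity
  have hc : 0 < 2 * T * π ^ 2 * (k : ℝ) ^ 2 := by positivity
  rw [abs_div, abs_neg, abs_of_pos hc, div_le_div_iff₀ hc (by positivity)]
  have h1 : |Real.cos (4 * π * k * T) - Real.cos (2 * π * k * T)| ≤ 2 := by
    refine (abs_sub _ _).trans ?_
    linarith [Real.abs_cos_le_one (4 * π * k * T), Real.abs_cos_le_one (2 * π * k * T)]
  have hpi : 1 ≤ π ^ 2 := by nlinarith [Real.pi_gt_three]
  have hTk : 0 < T * (k : ℝ) ^ 2 := by positivity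
  calc _ ≤ 2 * (T * (k : ℝ) ^ 2) := by gcongr
    _ ≤ 1 * (2 * T * π ^ 2 * (k : ℝ) ^ 2) := by nlinarith

lemma hasSum_cos_div_sq {x : ℝ} (hx : |x| ≤ 1) :
    HasSum (fun n : ℕ => 1 / (n : ℝ) ^ 2 * Real.cos (2 * π * n * x))
      (π ^ 2 * (x ^ 2 - |x| + 1 / 6)) := by
  have h := hasSum_one_div_nat_pow_mul_cos one_ne_zero (x := |x|) ⟨abs_nonneg x, hx⟩
  convert h using 1
  · ext n
    rw [mul_one]
    congr 1
    rcases abs_cases x with h | h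
    · rw [h.1]
    · rw [h.1, mul_neg, Real.cos_neg]
  · simp [Polynomial.bernoulli, Finset.sum_range_succ, bernoulli_eq_bernoulli'_of_ne_one,
      Polynomial.eval_add, Nat.factorial, bernoulli_one, sq_abs]
    ring

lemma summable_trapezoidCoeff {T : ℝ} (hT : 0 < T) : Summable (trapezoidCoeff T) := by
  have h : Summable fun k : ℤ => 1 / T * (1 / (k : ℝ) ^ 2) :=
    (Real.summable_one_div_int_pow.2 one_lt_two).mul_left _
  refine Summable.of_norm_bounded_eventually h ?_
  rw [Filter.eventually_cofinite]
  refine (Set.finite_singleton (0 : ℤ)).subset fun k hk => ?_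
  by_contra hk0
  apply hk
  rw [Real.norm_eq_abs]
  refine (abs_trapezoidCoeff_le_div hT hk0).trans (le_of_eq ?_)
  rw [one_div_mul_one_div]

lemma hasSum_trapezoid_aux {T : ℝ} (hT : 0 < T) (hT4 : T ≤ 1 / 4) {u : ℝ} (hu : |u| ≤ 1 / 2) :
    HasSum (fun k : ℤ => (trapezoidCoeff T k : ℂ) * expi (k * u)) (trapezoid T u : ℂ) := by
  have hsum : Summable fun k : ℤ => (trapezoidCoeff T k : ℂ) * expi (k * u) := by
    refine Summable.of_norm ((summable_trapezoidCoeff hT).norm.congr fun k => ?_)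
    rw [norm_mul, norm_expi, mul_one, Complex.norm_real]
  have hN := hsum.hasSum.nat_add_neg
  obtain ⟨u1, u2⟩ := abs_le.1 hu
  have c1 := hasSum_cos_div_sq (x := u - 2 * T) (abs_le.2 ⟨by linarith, by linarith⟩)
  have c2 := hasSum_cos_div_sq (x := u + 2 * T) (abs_le.2 ⟨by linarith, by linarith⟩)
  have c3 := hasSum_cos_div_sq (x := u - T) (abs_le.2 ⟨by linarith, by linarith⟩)
  have c4 := hasSum_cos_div_sq (x := u + T) (abs_le.2 ⟨by linarith, by linarith⟩)
  -- Four shifts of the Fourier series of the second Bernoulli polynomial; the bounds on T and u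
  -- keep the arguments in [-1, 1]. The absolute values combine to the trapezoid and the quadratic
  -- parts to -3T. Folding k with -k counts k = 0 twice, whence the 6T in `h0`; the surplus 3T is
  -- removed at the end. The cosine terms vanish at n = 0 because `1 / 0 = 0`.
  have hc := ((((c1.add c2).sub c3).sub c4).mul_left (-1 / (2 * T * π ^ 2)))
  have h0 := hasSum_single (f := fun n : ℕ => if n = 0 then 6 * T else 0) 0
    (fun n hn => if_neg hn)
  have hR := Complex.hasSum_ofReal.2 (hc.add h0)
  have hfun : (fun n : ℕ => (trapezoidCoeff T (n : ℤ) : ℂ) * expi (((n : ℤ) : ℝ) * u) +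
      (trapezoidCoeff T (-(n : ℤ)) : ℂ) * expi (((-(n : ℤ) : ℤ) : ℝ) * u)) = fun n : ℕ =>
      (((-1 / (2 * T * π ^ 2)) * (1 / (n : ℝ) ^ 2 * Real.cos (2 * π * n * (u - 2 * T)) +
        1 / (n : ℝ) ^ 2 * Real.cos (2 * π * n * (u + 2 * T)) -
        1 / (n : ℝ) ^ 2 * Real.cos (2 * π * n * (u - T)) -
        1 / (n : ℝ) ^ 2 * Real.cos (2 * π * n * (u + T))) +
        (if n = 0 then 6 * T else 0) : ℝ) : ℂ) := by
    ext n
    rcases eq_or_ne n 0 with rfl | hn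
    · simp [trapezoidCoeff, expi_zero]
      ring
    · have hn' : (n : ℝ) ≠ 0 := Nat.cast_ne_zero.2 hn
      have hev : trapezoidCoeff T (-(n : ℤ)) = trapezoidCoeff T n := by
        simp only [trapezoidCoeff, neg_eq_zero, Int.cast_neg, mul_neg, neg_mul, Real.cos_neg,
          neg_sq]
      have hcos : expi (((n : ℤ) : ℝ) * u) + expi (((-(n : ℤ) : ℤ) : ℝ) * u) =
          ((2 * Real.cos (2 * π * n * u) : ℝ) : ℂ) := by
        push_cast
        rw [Complex.two_cos, expi, expi]
        push_cast
        ring_nf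
      rw [hev, ← mul_add, hcos, ← Complex.ofReal_mul, if_neg hn, trapezoidCoeff,
        if_neg (by exact_mod_cast hn)]
      congr 1
      have e1 : Real.cos (2 * π * n * (u - 2 * T)) + Real.cos (2 * π * n * (u + 2 * T)) =
          2 * Real.cos (4 * π * n * T) * Real.cos (2 * π * n * u) := by
        rw [show 2 * π * n * (u - 2 * T) = 2 * π * n * u - 4 * π * n * T by ring,
          show 2 * π * n * (u + 2 * T) = 2 * π * n * u + 4 * π * n * T by ring,
          Real.cos_sub, Real.cos_add]
        ring
      have e2 : Real.cos (2 * π * n * (u - T)) + Real.cos (2 * π * n * (u + T)) =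
          2 * Real.cos (2 * π * n * T) * Real.cos (2 * π * n * u) := by
        rw [mul_sub, mul_add, Real.cos_sub, Real.cos_add]
        ring
      rw [show ∀ p a b c d : ℝ, p * a + p * b - p * c - p * d = p * ((a + b) - (c + d)) by
        intros; ring, e1, e2]
      push_cast
      have := Real.pi_ne_zero
      field_simp
      ring
  rw [hfun] at hN
  have heq := hN.unique hR
  convert hsum.hasSum using 1
  have h3 : (trapezoidCoeff T 0 : ℂ) * expi ((0 : ℤ) * u) = ((3 * T : ℝ) : ℂ) := by
    simp [trapezoidCoeff, expi_zero]
  rw [h3] at heq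
  rw [eq_sub_of_add_eq heq, ← Complex.ofReal_sub]
  congr 1
  rw [if_pos rfl, trapezoid]
  have := Real.pi_ne_zero
  field_simp
  ring

/-- Fourier expansion of the periodic trapezoid. -/
lemma hasSum_trapezoid {T : ℝ} (hT : 0 < T) (hT4 : T ≤ 1 / 4) (t : ℝ) :
    HasSum (fun k : ℤ => (trapezoidCoeff T k : ℂ) * expi (k * t))
      (trapezoid T (t - round t) : ℂ) := by
  convert hasSum_trapezoid_aux hT hT4 (abs_sub_round t) using 1
  ext k
  rw [show (k : ℝ) * t = k * (t - round t) + ((k * round t : ℤ) : ℝ) by push_cast; ring,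
    expi_add, expi_int, mul_one]

/-! ### The major arc multiplier -/

/-- Reduced fractions `a/q` in `[0, 1)` with `q ≤ Q`, as pairs `⟨q, a⟩`. -/
def reducedFractions (Q : ℕ) : Finset (Σ _ : ℕ, ℕ) :=
  (Finset.Icc 1 Q).sigma fun q => (Finset.range q).filter fun a => Nat.Coprime a q

/-- The half-width of the major arc around fractions with denominator `q`. -/
def arcWidth (Q : ℕ) (X : ℝ) (q : ℕ) : ℝ := Q / (q * X)

/-- The multiplier localising to the major arcs of level `Q`. -/
def arcMultiplier (Q : ℕ) (X t : ℝ) : ℝ :=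
  ∑ p ∈ reducedFractions Q,
    trapezoid (arcWidth Q X p.1) (t - p.2 / p.1 - round (t - (p.2 : ℝ) / p.1))

/-- The Fourier coefficients of `arcMultiplier`. -/
def arcCoeff (Q : ℕ) (X : ℝ) (k : ℤ) : ℂ :=
  ∑ q ∈ Finset.Icc 1 Q, (trapezoidCoeff (arcWidth Q X q) k : ℂ) * ramanujanSum q k

lemma mem_reducedFractions {Q : ℕ} {p : Σ _ : ℕ, ℕ} :
    p ∈ reducedFractions Q ↔ (1 ≤ p.1 ∧ p.1 ≤ Q) ∧ p.2 < p.1 ∧ Nat.Coprime p.2 p.1 := by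
  simp [reducedFractions]

lemma arcWidth_pos {Q : ℕ} {X : ℝ} (hX : 0 < X) {q : ℕ} (hq : 1 ≤ q) (hqQ : q ≤ Q) :
    0 < arcWidth Q X q := by
  have h1 : (0 : ℝ) < q := by exact_mod_cast hq
  have h2 : (0 : ℝ) < Q := by exact_mod_cast hq.trans hqQ
  unfold arcWidth
  positivity

lemma arcWidth_le {Q : ℕ} {X : ℝ} (hX : 4 * (Q : ℝ) ^ 2 ≤ X) {q : ℕ} (hq : 1 ≤ q) (hqQ : q ≤ Q) :
    arcWidth Q X q ≤ 1 / 4 := by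
  have h1 : (1 : ℝ) ≤ q := by exact_mod_cast hq
  have h2 : (1 : ℝ) ≤ Q := by exact_mod_cast hq.trans hqQ
  have hX0 : 0 < X := by nlinarith
  unfold arcWidth
  rw [div_le_iff₀ (by positivity)]
  nlinarith

lemma hasSum_arcMultiplier {Q : ℕ} {X : ℝ} (hX0 : 0 < X) (hX : 4 * (Q : ℝ) ^ 2 ≤ X) (t : ℝ) :
    HasSum (fun k : ℤ => arcCoeff Q X k * expi (k * t)) (arcMultiplier Q X t : ℂ) := by
  have h : HasSum (fun k : ℤ => ∑ p ∈ reducedFractions Q,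
      (trapezoidCoeff (arcWidth Q X p.1) k : ℂ) * expi (k * (t - (p.2 : ℝ) / p.1)))
      (∑ p ∈ reducedFractions Q, (trapezoid (arcWidth Q X p.1)
        (t - p.2 / p.1 - round (t - (p.2 : ℝ) / p.1)) : ℂ)) := by
    refine hasSum_sum fun p hp => ?_
    obtain ⟨⟨h1, h2⟩, -⟩ := mem_reducedFractions.1 hp
    exact hasSum_trapezoid (arcWidth_pos hX0 h1 h2) (arcWidth_le hX h1 h2) _
  rw [arcMultiplier, Complex.ofReal_sum]
  convert h using 1
  ext k
  rw [arcCoeff, reducedFractions, Finset.sum_sigma, Finset.sum_mul]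
  refine Finset.sum_congr rfl fun q _ => ?_
  rw [ramanujanSum, Finset.mul_sum, Finset.sum_mul]
  refine Finset.sum_congr rfl fun a _ => ?_
  rw [mul_sub, sub_eq_add_neg, expi_add]
  ring

lemma summable_norm_arcCoeff {Q : ℕ} {X : ℝ} (hX0 : 0 < X) :
    Summable fun k : ℤ => ‖arcCoeff Q X k‖ := by
  have h : Summable fun k : ℤ => ∑ q ∈ Finset.Icc 1 Q, |trapezoidCoeff (arcWidth Q X q) k| * q := by
    refine summable_sum fun q hq => ?_
    rw [Finset.mem_Icc] at hq
    exact (summable_trapezoidCoeff (arcWidth_pos hX0 hq.1 hq.2)).abs.mul_right _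
  refine h.of_nonneg_of_le (fun _ => norm_nonneg _) fun k => ?_
  refine (norm_sum_le _ _).trans (Finset.sum_le_sum fun q hq => ?_)
  rw [norm_mul, Complex.norm_real, Real.norm_eq_abs]
  gcongr
  refine (norm_sum_le _ _).trans ?_
  simp_rw [norm_expi]
  rw [Finset.sum_const, nsmul_eq_mul, mul_one]
  exact_mod_cast (Finset.card_filter_le _ _).trans (by simp)

/-- This is a bound for the total length of the arcs. When it is small, the mean of 1 - Λ stays away
from 0, which lets the level set argument divide by it. -/
lemma norm_arcCoeff_zero_le {Q : ℕ} {X : ℝ} (hX0 : 0 < X) :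
    ‖arcCoeff Q X 0‖ ≤ 3 * (Q : ℝ) ^ 2 / X := by
  calc _ ≤ ∑ q ∈ Finset.Icc 1 Q, 3 * (Q : ℝ) / X := by
        refine (norm_sum_le _ _).trans (Finset.sum_le_sum fun q hq => ?_)
        rw [Finset.mem_Icc] at hq
        have hw := arcWidth_pos hX0 hq.1 hq.2
        have hq0 : (0 : ℝ) < q := by exact_mod_cast hq.1
        rw [norm_mul, Complex.norm_real, Real.norm_eq_abs]
        have h1 : ‖ramanujanSum q 0‖ ≤ q := by
          refine (norm_sum_le _ _).trans ?_
          simp_rw [norm_expi]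
          rw [Finset.sum_const, nsmul_eq_mul, mul_one]
          exact_mod_cast (Finset.card_filter_le _ _).trans (by simp)
        calc _ ≤ 3 * arcWidth Q X q * q := by
              gcongr
              exact abs_trapezoidCoeff_le hw 0
          _ = _ := by rw [arcWidth]; field_simp
    _ = _ := by
        rw [Finset.sum_const, Nat.card_Icc, nsmul_eq_mul]
        simp
        ring

/-- The arcs with denominator q have coefficients decaying from |k| of order qX/Q; since q ≤ Q, the
common cutoff X serves for all q. The factor 1/q left over is the weight in the average of Ramanujan
sums. -/
lemma norm_arcCoeff_le {Q : ℕ} {X : ℝ} (hX0 : 0 < X) {k : ℤ} (hk : k ≠ 0) :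
    ‖arcCoeff Q X k‖ ≤ 3 * (Q / X) * (1 + Real.log Q) *
      (min 1 ((X / (k : ℝ)) ^ 2) * divCount Q k.natAbs) := by
  have hk' : (k : ℝ) ≠ 0 := Int.cast_ne_zero.2 hk
  have hk2 : 0 < (k : ℝ) ^ 2 := by positivity
  calc _ ≤ ∑ q ∈ Finset.Icc 1 Q, 3 * (Q / X) * min 1 ((X / (k : ℝ)) ^ 2) *
        (1 / (q : ℝ) * ‖ramanujanSum q k‖) := by
        refine (norm_sum_le _ _).trans (Finset.sum_le_sum fun q hq => ?_)
        rw [Finset.mem_Icc] at hq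
        have hw := arcWidth_pos hX0 hq.1 hq.2
        have hq0 : (0 : ℝ) < q := by exact_mod_cast hq.1
        have hQ0 : (0 : ℝ) < Q := by exact_mod_cast hq.1.trans hq.2
        have hqQ : (q : ℝ) ≤ Q := by exact_mod_cast hq.2
        rw [norm_mul, Complex.norm_real, Real.norm_eq_abs, ← mul_assoc]
        gcongr
        rcases le_total 1 ((X / (k : ℝ)) ^ 2) with h | h
        · rw [min_eq_left h]
          refine (abs_trapezoidCoeff_le hw k).trans (le_of_eq ?_)
          rw [arcWidth]
          field_simp
        · rw [min_eq_right h]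
          refine (abs_trapezoidCoeff_le_div hw hk).trans ?_
          rw [arcWidth]
          have e1 : 1 / (Q / (q * X) * (k : ℝ) ^ 2) = X * (q * q) / (Q * (k : ℝ) ^ 2 * q) := by
            field_simp
          have e2 : 3 * (Q / X) * (X / (k : ℝ)) ^ 2 * (1 / q) =
              X * (3 * (Q * Q)) / (Q * (k : ℝ) ^ 2 * q) := by field_simp
          have e3 : (q : ℝ) * q ≤ 3 * (Q * Q) := by nlinarith
          rw [e1, e2]
          gcongr
    _ = 3 * (Q / X) * min 1 ((X / (k : ℝ)) ^ 2) *
          ∑ q ∈ Finset.Icc 1 Q, 1 / (q : ℝ) * ‖ramanujanSum q k‖ := by rw [Finset.mul_sum]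
    _ ≤ 3 * (Q / X) * min 1 ((X / (k : ℝ)) ^ 2) * ((1 + Real.log Q) * divCount Q k.natAbs) := by
        gcongr
        exact sum_norm_ramanujanSum_div_le Q k
    _ = _ := by ring

/-- If the arcs at two fractions met, their cross difference, an integer, would be smaller than
4Q²/X ≤ 1 and hence zero; reducedness and the range of the numerators then identify the pairs. -/
lemma arcMultiplier_terms_disjoint {Q : ℕ} {X : ℝ} (hX0 : 0 < X) (hX : 4 * (Q : ℝ) ^ 2 ≤ X) (t : ℝ)
    {p p' : Σ _ : ℕ, ℕ} (hp : p ∈ reducedFractions Q) (hp' : p' ∈ reducedFractions Q)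
    (h : trapezoid (arcWidth Q X p.1) (t - p.2 / p.1 - round (t - (p.2 : ℝ) / p.1)) ≠ 0)
    (h' : trapezoid (arcWidth Q X p'.1) (t - p'.2 / p'.1 - round (t - (p'.2 : ℝ) / p'.1)) ≠ 0) :
    p = p' := by
  obtain ⟨q, a⟩ := p
  obtain ⟨q', a'⟩ := p'
  obtain ⟨⟨h1, h2⟩, h3, h4⟩ := mem_reducedFractions.1 hp
  obtain ⟨⟨h1', h2'⟩, h3', h4'⟩ := mem_reducedFractions.1 hp'
  simp only at h h' h1 h2 h3 h4 h1' h2' h3' h4'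
  set m := round (t - (a : ℝ) / q)
  set m' := round (t - (a' : ℝ) / q')
  have w := lt_of_not_ge fun hle => h (trapezoid_eq_zero (arcWidth_pos hX0 h1 h2) hle)
  have w' := lt_of_not_ge fun hle => h' (trapezoid_eq_zero (arcWidth_pos hX0 h1' h2') hle)
  have hq : (0 : ℝ) < q := by exact_mod_cast h1
  have hq' : (0 : ℝ) < q' := by exact_mod_cast h1'
  have hqQ : (q : ℝ) ≤ Q := by exact_mod_cast h2
  have hqQ' : (q' : ℝ) ≤ Q := by exact_mod_cast h2'
  have hQ : (0 : ℝ) < Q := hq.trans_le hqQ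
  have hint : ((a + m * q : ℤ) : ℝ) * q' - ((a' + m' * q' : ℤ) : ℝ) * q =
      q * q' * ((t - a' / q' - m') - (t - a / q - m)) := by
    push_cast
    field_simp
    ring
  have hlt : |(((a + m * q) * q' - (a' + m' * q') * q : ℤ) : ℝ)| < 1 := by
    have hd : |(t - a' / q' - m') - (t - a / q - m)| < 2 * arcWidth Q X q' + 2 * arcWidth Q X q :=
      (abs_sub _ _).trans_lt (add_lt_add w' w)
    rw [Int.cast_sub, Int.cast_mul, Int.cast_mul, Int.cast_natCast, Int.cast_natCast, hint, abs_mul,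
      abs_of_pos (by positivity)]
    calc _ < q * q' * (2 * arcWidth Q X q' + 2 * arcWidth Q X q) := by gcongr
      _ = (2 * Q * (q + q')) / X := by unfold arcWidth; field_simp
      _ ≤ (2 * Q * (Q + Q)) / X := by gcongr
      _ ≤ 1 := by rw [div_le_one hX0]; nlinarith
  have hz : ((a : ℤ) + m * q) * q' - (a' + m' * q') * q = 0 := by
    rw [← Int.abs_lt_one_iff]
    exact_mod_cast hlt
  have hz' : ((a : ℤ) + m * q) * q' = (a' + m' * q') * q := by linarith
  have cop : IsCoprime ((a : ℤ) + m * q) q := by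
    rw [IsCoprime.add_mul_right_left_iff]
    exact Nat.isCoprime_iff_coprime.2 h4
  have cop' : IsCoprime ((a' : ℤ) + m' * q') q' := by
    rw [IsCoprime.add_mul_right_left_iff]
    exact Nat.isCoprime_iff_coprime.2 h4'
  have d1 : (q : ℤ) ∣ q' := cop.symm.dvd_of_dvd_mul_left (hz' ▸ Dvd.intro_left _ rfl)
  have d2 : (q' : ℤ) ∣ q := cop'.symm.dvd_of_dvd_mul_left (hz' ▸ Dvd.intro_left _ rfl)
  have hqq : q = q' := Nat.dvd_antisymm (Int.natCast_dvd_natCast.1 d1) (Int.natCast_dvd_natCast.1 d2)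
  subst hqq
  have hq0 : (q : ℤ) ≠ 0 := by exact_mod_cast (by omega : q ≠ 0)
  have haa := mul_right_cancel₀ hq0 hz'
  have hmod := congrArg (· % (q : ℤ)) haa
  simp only [Int.add_mul_emod_self_right] at hmod
  have : a % q = a' % q := by exact_mod_cast hmod
  rw [Nat.mod_eq_of_lt h3, Nat.mod_eq_of_lt h3'] at this
  rw [this]

lemma arcMultiplier_eq_of_ne_zero {Q : ℕ} {X : ℝ} (hX0 : 0 < X) (hX : 4 * (Q : ℝ) ^ 2 ≤ X) (t : ℝ)
    {p : Σ _ : ℕ, ℕ} (hp : p ∈ reducedFractions Q)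
    (h : trapezoid (arcWidth Q X p.1) (t - p.2 / p.1 - round (t - (p.2 : ℝ) / p.1)) ≠ 0) :
    arcMultiplier Q X t =
      trapezoid (arcWidth Q X p.1) (t - p.2 / p.1 - round (t - (p.2 : ℝ) / p.1)) := by
  refine Finset.sum_eq_single_of_mem p hp fun p' hp' hne => ?_
  by_contra h'
  exact hne (arcMultiplier_terms_disjoint hX0 hX t hp' hp h' h)

lemma arcMultiplier_mem_Icc {Q : ℕ} {X : ℝ} (hX0 : 0 < X) (hX : 4 * (Q : ℝ) ^ 2 ≤ X) (t : ℝ) :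
    arcMultiplier Q X t ∈ Set.Icc (0 : ℝ) 1 := by
  by_cases hex : ∃ p ∈ reducedFractions Q,
      trapezoid (arcWidth Q X p.1) (t - p.2 / p.1 - round (t - (p.2 : ℝ) / p.1)) ≠ 0
  · obtain ⟨p, hp, h⟩ := hex
    obtain ⟨⟨h1, h2⟩, -⟩ := mem_reducedFractions.1 hp
    have hw := arcWidth_pos hX0 h1 h2
    rw [arcMultiplier_eq_of_ne_zero hX0 hX t hp h]
    exact ⟨trapezoid_nonneg hw _, trapezoid_le_one hw _⟩
  · push Not at hex
    rw [arcMultiplier, Finset.sum_eq_zero hex]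
    simp

lemma arcMultiplier_eq_one {Q : ℕ} {X : ℝ} (hX0 : 0 < X) (hX : 4 * (Q : ℝ) ^ 2 ≤ X) {t : ℝ} {r : ℚ}
    (hr : r.den ≤ Q) (ht : |t - r| ≤ Q / (r.den * X)) : arcMultiplier Q X t = 1 := by
  have hden : (0 : ℤ) < r.den := by exact_mod_cast r.den_pos
  have hden' : (r.den : ℝ) ≠ 0 := by exact_mod_cast r.den_nz
  set a : ℕ := (r.num % r.den).toNat with ha
  have ha' : (a : ℤ) = r.num % r.den := Int.toNat_of_nonneg (Int.emod_nonneg _ hden.ne')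
  have haR : (a : ℝ) = r.num - r.den * (r.num / r.den : ℤ) := by
    have : (a : ℤ) = r.num - r.den * (r.num / r.den) := by rw [ha', Int.emod_def]
    exact_mod_cast this
  have hp : (⟨r.den, a⟩ : Σ _ : ℕ, ℕ) ∈ reducedFractions Q := by
    refine mem_reducedFractions.2 ⟨⟨r.den_pos, hr⟩, ?_, ?_⟩
    · have := Int.emod_lt_of_pos r.num hden
      simp only
      omega
    · have h1 : IsCoprime r.num r.den := Int.isCoprime_iff_gcd_eq_one.2 r.reduced
      have h2 : (a : ℤ) = r.num + (-(r.num / r.den)) * r.den := by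
        rw [ha', Int.emod_def]; ring
      apply Nat.isCoprime_iff_coprime.1
      rw [h2]
      exact IsCoprime.add_mul_right_left_iff.2 h1
  have hw := arcWidth_pos hX0 r.den_pos hr
  have hle : |t - a / r.den - round (t - (a : ℝ) / r.den)| ≤ arcWidth Q X r.den := by
    refine (round_le _ (r.num / r.den)).trans (le_trans (le_of_eq ?_) ht)
    congr 1
    have hrr : (r : ℝ) = r.num / r.den := by exact_mod_cast r.num_div_den.symm
    rw [haR, hrr]
    field_simp
    ring
  have hone := trapezoid_eq_one hw hle
  rw [arcMultiplier_eq_of_ne_zero hX0 hX t hp (by rw [hone]; exact one_ne_zero)]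
  exact hone

/-- The Weyl sum is small off the major arcs, uniformly in the spatial variable. -/
lemma norm_weylSum_mul_one_sub_le {N Q : ℕ} (hN : 1 ≤ N) (hQ : 1 ≤ Q)
    (hX : 4 * (Q : ℝ) ^ 2 ≤ (N : ℝ) ^ 2) (x t : ℝ) :
    ‖weylSum (1 / (N : ℝ) ^ 2) x t‖ * |1 - arcMultiplier Q ((N : ℝ) ^ 2) t| ≤
      4 * gaussConst * (N / √Q + √N) := by
  have hX0 : (0 : ℝ) < (N : ℝ) ^ 2 := by positivity
  have hg := one_le_gaussConst
  have hpos : 0 ≤ 4 * gaussConst * (N / √Q + √N) := by positivity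
  by_cases h : ∀ r : ℚ, r.den ≤ Q → (Q : ℝ) / (r.den * N ^ 2) < |t - r|
  · have h1 := norm_weylSum_minor N hN x t hQ h
    obtain ⟨h2, h3⟩ := arcMultiplier_mem_Icc hX0 hX t
    calc _ ≤ ‖weylSum (1 / (N : ℝ) ^ 2) x t‖ * 1 := by
          gcongr
          exact abs_le.2 ⟨by linarith, by linarith⟩
      _ ≤ _ := by rwa [mul_one]
  · push Not at h
    obtain ⟨r, hr, hle⟩ := h
    rw [arcMultiplier_eq_one hX0 hX hr hle, sub_self, abs_zero, mul_zero]
    exact hpos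

/-! ### The Gaussian-weighted Schrödinger kernel -/

/-- The Gaussian weight `e^{-πs|n|²}` on `ℤᵈ`. -/
def gaussWeight {d : ℕ} (s : ℝ) (n : Fin d → ℤ) : ℝ := ∏ j, rexp (-π * s * (n j : ℝ) ^ 2)

lemma gaussWeight_pos {d : ℕ} (s : ℝ) (n : Fin d → ℤ) : 0 < gaussWeight s n :=
  Finset.prod_pos fun _ _ => Real.exp_pos _

lemma gaussWeight_le_one {d : ℕ} {s : ℝ} (hs : 0 < s) (n : Fin d → ℤ) : gaussWeight s n ≤ 1 := by
  refine Finset.prod_le_one (fun _ _ => (Real.exp_pos _).le) fun j _ => ?_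
  rw [Real.exp_le_one_iff]
  have : 0 ≤ π * s * (n j : ℝ) ^ 2 := by positivity
  linarith

lemma gaussWeight_cons {d : ℕ} (s : ℝ) (m : ℤ) (n : Fin d → ℤ) :
    gaussWeight s (Fin.cons m n : Fin (d + 1) → ℤ) =
      rexp (-π * s * (m : ℝ) ^ 2) * gaussWeight s n := by
  simp [gaussWeight, Fin.prod_univ_succ]

lemma le_gaussWeight_of_mem_freqBox {d N : ℕ} (hN : 1 ≤ N) {n : Fin d → ℤ} (hn : n ∈ freqBox d N) :
    rexp (-π) ^ d ≤ gaussWeight (1 / (N : ℝ) ^ 2) n := by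
  have hN0 : (0 : ℝ) < (N : ℝ) ^ 2 := by positivity
  rw [gaussWeight, show rexp (-π) ^ d = ∏ _j : Fin d, rexp (-π) by simp]
  refine Finset.prod_le_prod (fun _ _ => (Real.exp_pos _).le) fun j _ => ?_
  have h := Finset.mem_Icc.1 (Fintype.mem_piFinset.1 hn j)
  have h2 : (n j : ℝ) ^ 2 ≤ (N : ℝ) ^ 2 := by
    rw [sq_le_sq, Nat.abs_cast]
    exact abs_le.2 ⟨by exact_mod_cast h.1, by exact_mod_cast h.2⟩
  apply Real.exp_le_exp.2
  have h3 : 1 / (N : ℝ) ^ 2 * (n j : ℝ) ^ 2 ≤ 1 := by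
    rw [one_div_mul_eq_div, div_le_one hN0]; exact h2
  nlinarith [Real.pi_pos]

lemma summable_gaussWeight (d : ℕ) {s : ℝ} (hs : 0 < s) :
    Summable fun n : Fin d → ℤ => gaussWeight s n := by
  induction d with
  | zero => exact (hasSum_fintype _).summable
  | succ d ih =>
    rw [← (Fin.consEquiv fun _ : Fin (d + 1) => ℤ).summable_iff]
    have h := (summable_gauss_zero hs).mul_of_nonneg ih (fun _ => (Real.exp_pos _).le)
      fun n => (gaussWeight_pos s n).le
    refine h.congr fun p => ?_
    exact (gaussWeight_cons s p.1 p.2).symm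

lemma tsum_gaussWeight (d : ℕ) {s : ℝ} (hs : 0 < s) :
    ∑' n : Fin d → ℤ, gaussWeight s n = (∑' m : ℤ, rexp (-π * s * (m : ℝ) ^ 2)) ^ d := by
  induction d with
  | zero => simp [gaussWeight]
  | succ d ih =>
    rw [← (Fin.consEquiv fun _ : Fin (d + 1) => ℤ).tsum_eq, pow_succ', ← ih,
      tsum_mul_tsum_of_summable_norm (summable_gauss_zero hs).norm
        (summable_gaussWeight d hs).norm]
    exact tsum_congr fun p => gaussWeight_cons s p.1 p.2

lemma tsum_gaussWeight_le (d : ℕ) {N : ℕ} (hN : 1 ≤ N) :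
    ∑' n : Fin d → ℤ, gaussWeight (1 / (N : ℝ) ^ 2) n ≤ (2 * gaussConst * N) ^ d := by
  have hN0 : (1 : ℝ) ≤ N := by exact_mod_cast hN
  rw [tsum_gaussWeight d (by positivity)]
  have hg := one_le_gaussConst
  refine pow_le_pow_left₀ (tsum_nonneg fun _ => (Real.exp_pos _).le) ?_ d
  refine (tsum_gauss_zero_le (by positivity)).trans ?_
  rw [Real.sqrt_div (by positivity), Real.sqrt_sq (by positivity), Real.sqrt_one, one_div_one_div]
  nlinarith

/-- The phase `n·y + Q(n)t`. -/
def phase {d : ℕ} (θ : Fin d → ℝ) (n : Fin d → ℤ) (y : Fin d → ℝ) (t : ℝ) : ℝ :=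
  (∑ j, n j * y j) + quadForm θ n * t

lemma phase_cons {d : ℕ} {θ : Fin (d + 1) → ℝ} (hθ : θ 0 = 1) (m : ℤ) (n : Fin d → ℤ)
    (y : Fin (d + 1) → ℝ) (t : ℝ) :
    phase θ (Fin.cons m n : Fin (d + 1) → ℤ) y t =
      (m * y 0 + (m : ℝ) ^ 2 * t) + phase (Fin.tail θ) n (Fin.tail y) t := by
  simp only [phase, quadForm, Fin.sum_univ_succ, Fin.cons_zero, Fin.cons_succ, hθ, Fin.tail]
  ring

lemma summable_norm_kernel {d : ℕ} (θ : Fin d → ℝ) {s : ℝ} (hs : 0 < s) (y : Fin d → ℝ) (t : ℝ) :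
    Summable fun n : Fin d → ℤ => ‖(gaussWeight s n : ℂ) * expi (phase θ n y t)‖ := by
  refine (summable_gaussWeight d hs).congr fun n => ?_
  rw [norm_mul, norm_expi, mul_one, Complex.norm_real, Real.norm_of_nonneg (gaussWeight_pos s n).le]

/-- Only the first coordinate is used: the others are estimated trivially. -/
lemma norm_kernel_le {d : ℕ} {θ : Fin (d + 1) → ℝ} (hθ : θ 0 = 1) {N : ℕ} (hN : 1 ≤ N)
    (y : Fin (d + 1) → ℝ) (t : ℝ) :
    ‖∑' n : Fin (d + 1) → ℤ, (gaussWeight (1 / (N : ℝ) ^ 2) n : ℂ) * expi (phase θ n y t)‖ ≤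
      (2 * gaussConst * N) ^ d * ‖weylSum (1 / (N : ℝ) ^ 2) (y 0) t‖ := by
  have hN0 : (1 : ℝ) ≤ N := by exact_mod_cast hN
  have hs : (0 : ℝ) < 1 / (N : ℝ) ^ 2 := by positivity
  set s := 1 / (N : ℝ) ^ 2
  have h1 : Summable fun m : ℤ =>
      ‖((rexp (-π * s * (m : ℝ) ^ 2) : ℝ) : ℂ) * expi (m * y 0 + (m : ℝ) ^ 2 * t)‖ := by
    refine (summable_gauss_zero hs).congr fun n => ?_
    rw [norm_mul, norm_expi, mul_one, Complex.norm_real, Real.norm_of_nonneg (Real.exp_pos _).le]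
  have h2 := summable_norm_kernel (Fin.tail θ) hs (Fin.tail y) t
  -- The kernel is a product over coordinates; as `θ 0 = 1`, its first factor is the Weyl sum at t
  -- itself, 1-periodic in t like the arc multiplier.
  have e : ∑' n : Fin (d + 1) → ℤ, (gaussWeight s n : ℂ) * expi (phase θ n y t) =
      weylSum s (y 0) t *
        ∑' n : Fin d → ℤ, (gaussWeight s n : ℂ) * expi (phase (Fin.tail θ) n (Fin.tail y) t) := by
    rw [weylSum, tsum_mul_tsum_of_summable_norm h1 h2,
      ← (Fin.consEquiv fun _ : Fin (d + 1) => ℤ).tsum_eq]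
    refine tsum_congr fun p => ?_
    change (gaussWeight s (Fin.cons p.1 p.2 : Fin (d + 1) → ℤ) : ℂ) *
      expi (phase θ (Fin.cons p.1 p.2 : Fin (d + 1) → ℤ) y t) = _
    rw [gaussWeight_cons, phase_cons hθ, expi_add]
    push_cast
    ring
  rw [e, norm_mul, mul_comm]
  gcongr
  refine le_trans ?_ (tsum_gaussWeight_le d hN)
  refine tsum_of_norm_bounded (summable_gaussWeight d hs).hasSum fun n => ?_
  rw [norm_mul, norm_expi, mul_one, Complex.norm_real, Real.norm_of_nonneg (gaussWeight_pos s n).le]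

/-- The coefficients of `1 - Λ`, with `Λ` the major arc multiplier. -/
def minorCoeff (Q : ℕ) (X : ℝ) (k : ℤ) : ℂ := (if k = 0 then 1 else 0) - arcCoeff Q X k

lemma summable_norm_minorCoeff {Q : ℕ} {X : ℝ} (hX0 : 0 < X) :
    Summable fun k : ℤ => ‖minorCoeff Q X k‖ := by
  have h : Summable fun k : ℤ => ‖(if k = 0 then 1 else 0 : ℂ)‖ :=
    summable_of_ne_finset_zero (s := {0}) fun k hk => by
      rw [if_neg (by simpa using hk), norm_zero]
  exact (h.add (summable_norm_arcCoeff hX0)).of_nonneg_of_le (fun _ => norm_nonneg _)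
    fun k => norm_sub_le _ _

lemma tsum_minorCoeff {Q : ℕ} {X : ℝ} (hX0 : 0 < X) (hX : 4 * (Q : ℝ) ^ 2 ≤ X) (t : ℝ) :
    ∑' k : ℤ, minorCoeff Q X k * expi (k * t) = ((1 - arcMultiplier Q X t : ℝ) : ℂ) := by
  have h1 : HasSum (fun k : ℤ => if k = 0 then (1 : ℂ) else 0) 1 := by
    simpa using hasSum_ite_eq (0 : ℤ) (1 : ℂ)
  have h2 := h1.sub (hasSum_arcMultiplier hX0 hX t)
  rw [← Complex.ofReal_one, ← Complex.ofReal_sub] at h2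
  rw [← h2.tsum_eq]
  refine tsum_congr fun k => ?_
  rw [minorCoeff, sub_mul]
  congr 1
  split_ifs with h
  · rw [h]; simp [expi_zero]
  · simp

/-- Uniform bound for the minor arc part of the kernel. -/
lemma norm_minor_kernel_le {d : ℕ} {θ : Fin (d + 1) → ℝ} (hθ : θ 0 = 1) {N Q : ℕ} (hN : 1 ≤ N)
    (hQ : 1 ≤ Q) (hX : 4 * (Q : ℝ) ^ 2 ≤ (N : ℝ) ^ 2) (y : Fin (d + 1) → ℝ) (t : ℝ) :
    ‖∑' p : (Fin (d + 1) → ℤ) × ℤ,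
      (gaussWeight (1 / (N : ℝ) ^ 2) p.1 * minorCoeff Q ((N : ℝ) ^ 2) p.2) *
        expi (phase θ p.1 y t + p.2 * t)‖ ≤
      (2 * gaussConst * N) ^ d * (4 * gaussConst * (N / √Q + √N)) := by
  have hN0 : (1 : ℝ) ≤ N := by exact_mod_cast hN
  have hs : (0 : ℝ) < 1 / (N : ℝ) ^ 2 := by positivity
  have hX0 : (0 : ℝ) < (N : ℝ) ^ 2 := by positivity
  have hg := one_le_gaussConst
  have h2 : Summable fun k : ℤ => ‖minorCoeff Q ((N : ℝ) ^ 2) k * expi (k * t)‖ := by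
    refine (summable_norm_minorCoeff (Q := Q) hX0).congr fun k => ?_
    rw [norm_mul, norm_expi, mul_one]
  have e := tsum_mul_tsum_of_summable_norm (summable_norm_kernel θ hs y t) h2
  have e' : ∑' p : (Fin (d + 1) → ℤ) × ℤ,
      (gaussWeight (1 / (N : ℝ) ^ 2) p.1 * minorCoeff Q ((N : ℝ) ^ 2) p.2) *
        expi (phase θ p.1 y t + p.2 * t) =
      (∑' n : Fin (d + 1) → ℤ, (gaussWeight (1 / (N : ℝ) ^ 2) n : ℂ) * expi (phase θ n y t)) *
        ∑' k : ℤ, minorCoeff Q ((N : ℝ) ^ 2) k * expi (k * t) := by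
    rw [e]
    refine tsum_congr fun p => ?_
    rw [expi_add]
    ring
  rw [e', norm_mul, tsum_minorCoeff hX0 hX, Complex.norm_real, Real.norm_eq_abs]
  calc _ ≤ (2 * gaussConst * N) ^ d * ‖weylSum (1 / (N : ℝ) ^ 2) (y 0) t‖ *
        |1 - arcMultiplier Q ((N : ℝ) ^ 2) t| := by
        gcongr
        exact norm_kernel_le hθ hN y t
    _ = (2 * gaussConst * N) ^ d * (‖weylSum (1 / (N : ℝ) ^ 2) (y 0) t‖ *
        |1 - arcMultiplier Q ((N : ℝ) ^ 2) t|) := by ring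
    _ ≤ _ := by
        exact mul_le_mul_of_nonneg_left (norm_weylSum_mul_one_sub_le hN hQ hX (y 0) t)
          (by positivity)

/-! ### The `TT*` argument -/

section TTStar

variable {α ι : Type*} [MeasurableSpace α] {μ : Measure α}

/-- The generalized Fourier coefficient `⟨e, Θ⟩`. -/
def coeffWith (μ : Measure α) (Θ e : α → ℂ) : ℂ := ∫ z, Θ z * (starRingEnd ℂ) (e z) ∂μ

lemma norm_coeffWith_le {Θ e : α → ℂ} (he : ∀ z, ‖e z‖ = 1) :
    ‖coeffWith μ Θ e‖ ≤ ∫ z, ‖Θ z‖ ∂μ := by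
  refine (norm_integral_le_integral_norm _).trans (le_of_eq ?_)
  congr 1
  ext z
  rw [norm_mul, RCLike.norm_conj, he, mul_one]

variable [IsFiniteMeasure μ]

lemma integrable_of_norm_le_one {f : α → ℂ} (hf : Measurable f) (h : ∀ z, ‖f z‖ ≤ 1) :
    Integrable f μ :=
  Integrable.of_bound hf.aestronglyMeasurable 1 (Filter.Eventually.of_forall h)

/-- A diagonal form in the coefficients of `Θ` is controlled by the supremum of its kernel. -/
lemma norm_tsum_mul_coeffWith_sq_le [Countable ι] {e : ι → α → ℂ} (hem : ∀ i, Measurable (e i))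
    (he : ∀ i z, ‖e i z‖ = 1) {a : ι → ℂ} (ha : Summable fun i => ‖a i‖) {Θ : α → ℂ}
    (hΘm : Measurable Θ) (hΘ : ∀ z, ‖Θ z‖ ≤ 1) {B : ℝ}
    (hB : ∀ z z', ‖∑' i, a i * ((starRingEnd ℂ) (e i z) * e i z')‖ ≤ B) :
    ‖∑' i, a i * ((‖coeffWith μ Θ (e i)‖ ^ 2 : ℝ) : ℂ)‖ ≤ B * (∫ z, ‖Θ z‖ ∂μ) ^ 2 := by
  have hcm : ∀ i, Measurable fun z => (starRingEnd ℂ) (e i z) := fun i =>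
    Complex.continuous_conj.measurable.comp (hem i)
  have hcΘ : Measurable fun z => (starRingEnd ℂ) (Θ z) :=
    Complex.continuous_conj.measurable.comp hΘm
  -- The square |⟨Θ, e_i⟩|² is a double integral; summing over i under the integral sign produces
  -- the kernel bounded in `hB`.
  set F : ι → α × α → ℂ := fun i p => a i * ((Θ p.1 * (starRingEnd ℂ) (e i p.1)) *
    ((starRingEnd ℂ) (Θ p.2) * e i p.2)) with hF
  have hFm : ∀ i, Measurable (F i) := fun i => by
    have := hem i
    have := hcm i
    simp only [hF]
    fun_prop
  have hFn : ∀ i p, ‖F i p‖ = ‖a i‖ * (‖Θ p.1‖ * ‖Θ p.2‖) := by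
    intro i p
    simp only [hF, norm_mul, RCLike.norm_conj, he, mul_one]
  have hFint : ∀ i, Integrable (F i) (μ.prod μ) := fun i =>
    Integrable.of_bound (hFm i).aestronglyMeasurable ‖a i‖ (Filter.Eventually.of_forall fun p => by
      rw [hFn]
      exact mul_le_of_le_one_right (norm_nonneg _)
        (mul_le_one₀ (hΘ _) (norm_nonneg _) (hΘ _)))
  have hIF : ∀ i, ∫ p, F i p ∂(μ.prod μ) = a i * ((‖coeffWith μ Θ (e i)‖ ^ 2 : ℝ) : ℂ) := by
    intro i
    simp only [hF]
    rw [integral_const_mul, integral_prod_mul (fun z => Θ z * (starRingEnd ℂ) (e i z))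
      (fun z => (starRingEnd ℂ) (Θ z) * e i z)]
    congr 1
    have h2 : ∫ z, (starRingEnd ℂ) (Θ z) * e i z ∂μ = (starRingEnd ℂ) (coeffWith μ Θ (e i)) := by
      rw [coeffWith, ← integral_conj]
      simp
    rw [h2]
    change coeffWith μ Θ (e i) * _ = _
    rw [Complex.mul_conj']
    push_cast
    rfl
  have hsum : Summable fun i => ∫ p, ‖F i p‖ ∂(μ.prod μ) := by
    simp_rw [hFn, integral_const_mul]
    exact ha.mul_right _
  have key := integral_tsum_of_summable_integral_norm hFint hsum
  simp_rw [hIF] at key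
  rw [key]
  calc _ ≤ ∫ p : α × α, B * (‖Θ p.1‖ * ‖Θ p.2‖) ∂(μ.prod μ) := by
        refine norm_integral_le_of_norm_le ?_ (Filter.Eventually.of_forall fun p => ?_)
        · refine (Integrable.of_bound (C := 1) ?_ (Filter.Eventually.of_forall fun p => ?_)).const_mul B
          · exact (by fun_prop : Measurable fun p : α × α => ‖Θ p.1‖ * ‖Θ p.2‖).aestronglyMeasurable
          · rw [Real.norm_of_nonneg (by positivity)]
            exact mul_le_one₀ (hΘ _) (norm_nonneg _) (hΘ _)
        · have : ∑' i, F i p = (Θ p.1 * (starRingEnd ℂ) (Θ p.2)) *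
              ∑' i, a i * ((starRingEnd ℂ) (e i p.1) * e i p.2) := by
            rw [← tsum_mul_left]
            refine tsum_congr fun i => ?_
            simp only [hF]
            ring
          rw [this, norm_mul, norm_mul, RCLike.norm_conj, mul_comm]
          gcongr
          exact hB _ _
    _ = _ := by
        rw [integral_const_mul, integral_prod_mul (fun z => ‖Θ z‖) (fun z => ‖Θ z‖)]
        ring

/-- Bessel's inequality for a bounded orthonormal system. -/
lemma sum_norm_coeffWith_sq_le {e : ι → α → ℂ} (hem : ∀ i, Measurable (e i))
    (he : ∀ i z, ‖e i z‖ = 1)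
    (hort : ∀ i j, i ≠ j → ∫ z, (starRingEnd ℂ) (e i z) * e j z ∂μ = 0)
    (hμ : μ Set.univ = 1) {Θ : α → ℂ} (hΘm : Measurable Θ) (hΘ : ∀ z, ‖Θ z‖ ≤ 1) (J : Finset ι) :
    ∑ i ∈ J, ‖coeffWith μ Θ (e i)‖ ^ 2 ≤ ∫ z, ‖Θ z‖ ∂μ := by
  classical
  have hprob : IsProbabilityMeasure μ := ⟨hμ⟩
  have hLe : ∀ i, MemLp (e i) 2 μ := fun i =>
    MemLp.of_bound (hem i).aestronglyMeasurable 1 (Filter.Eventually.of_forall fun z => (he i z).le)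
  have hLΘ : MemLp Θ 2 μ :=
    MemLp.of_bound hΘm.aestronglyMeasurable 1 (Filter.Eventually.of_forall hΘ)
  have hinner : ∀ {f g : α → ℂ} (hf : MemLp f 2 μ) (hg : MemLp g 2 μ),
      inner ℂ (hf.toLp f) (hg.toLp g) = ∫ z, (starRingEnd ℂ) (f z) * g z ∂μ := by
    intro f g hf hg
    rw [L2.inner_def]
    refine integral_congr_ae ?_
    filter_upwards [hf.coeFn_toLp, hg.coeFn_toLp] with z h1 h2
    rw [h1, h2, RCLike.inner_apply, mul_comm]
  have hon : Orthonormal ℂ fun i => (hLe i).toLp (e i) := by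
    rw [orthonormal_iff_ite]
    intro i j
    rw [hinner]
    split_ifs with h
    · subst h
      have : ∀ z, (starRingEnd ℂ) (e i z) * e i z = 1 := by
        intro z
        rw [Complex.conj_mul', he]
        simp
      simp_rw [this]
      simp
    · exact hort i j h
  have hB := hon.sum_inner_products_le (hLΘ.toLp Θ) (s := J)
  have h1 : ‖hLΘ.toLp Θ‖ ^ 2 ≤ ∫ z, ‖Θ z‖ ∂μ := by
    have h2 : ((‖hLΘ.toLp Θ‖ ^ 2 : ℝ) : ℂ) = ((∫ z, ‖Θ z‖ ^ 2 ∂μ : ℝ) : ℂ) := by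
      have h3 := inner_self_eq_norm_sq_to_K (𝕜 := ℂ) (hLΘ.toLp Θ)
      rw [hinner] at h3
      rw [← integral_complex_ofReal]
      push_cast
      refine h3.symm.trans ?_
      congr 1
      ext z
      rw [Complex.conj_mul']
    rw [Complex.ofReal_inj.1 h2]
    refine integral_mono (Integrable.of_bound (by fun_prop) 1
      (Filter.Eventually.of_forall fun z => ?_)) (integrable_of_norm_le_one hΘm hΘ).norm fun z => ?_
    · rw [norm_pow, norm_norm]
      exact pow_le_one₀ (norm_nonneg _) (hΘ z)
    · exact pow_le_of_le_one (norm_nonneg _) (hΘ z) two_ne_zero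
  refine le_trans (le_of_eq ?_) (hB.trans h1)
  refine Finset.sum_congr rfl fun i _ => ?_
  rw [hinner, coeffWith]
  simp_rw [mul_comm]

/-- Duality: a lower bound for `|F|` on `A` passes to the coefficients of a unimodular function
supported in `A`. -/
lemma exists_dual_function {e : ι → α → ℂ} (hem : ∀ i, Measurable (e i))
    (he : ∀ i z, ‖e i z‖ = 1) (S : Finset ι) (c : ι → ℂ) (hc : ∑ i ∈ S, ‖c i‖ ^ 2 ≤ 1)
    {A : Set α} (hA : MeasurableSet A) {lam : ℝ} (hlam : 0 ≤ lam)
    (hF : ∀ z ∈ A, lam ≤ ‖∑ i ∈ S, c i * e i z‖) :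
    ∃ Θ : α → ℂ, Measurable Θ ∧ (∀ z, ‖Θ z‖ ≤ 1) ∧ (∫ z, ‖Θ z‖ ∂μ) ≤ μ.real A ∧
      lam ^ 2 * μ.real A ^ 2 ≤ ∑ i ∈ S, ‖coeffWith μ Θ (e i)‖ ^ 2 := by
  set F : α → ℂ := fun z => ∑ i ∈ S, c i * e i z with hFdef
  have hFm : Measurable F := Finset.measurable_sum S fun i _ => (hem i).const_mul _
  -- At zeros of F the quotient is 0 by convention, so ‖Θ‖ ≤ 1 holds everywhere.
  set Θ : α → ℂ := A.indicator fun z => F z / ‖F z‖ with hΘdef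
  have hΘm : Measurable Θ :=
    (hFm.div (Complex.measurable_ofReal.comp hFm.norm)).indicator hA
  have hΘA : ∀ z, ‖Θ z‖ ≤ A.indicator (fun _ => (1 : ℝ)) z := by
    intro z
    by_cases hz : z ∈ A
    · rw [hΘdef, Set.indicator_of_mem hz, Set.indicator_of_mem hz, norm_div, Complex.norm_real,
        norm_norm]
      exact div_self_le_one _
    · rw [hΘdef, Set.indicator_of_notMem hz, Set.indicator_of_notMem hz, norm_zero]
  have hΘ : ∀ z, ‖Θ z‖ ≤ 1 := fun z => (hΘA z).trans
    (Set.indicator_le_self' (fun _ _ => zero_le_one) z)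
  have hindint : Integrable (A.indicator fun _ => (1 : ℝ)) μ :=
    (integrable_const 1).indicator hA
  refine ⟨Θ, hΘm, hΘ, ?_, ?_⟩
  · calc _ ≤ ∫ z, A.indicator (fun _ => (1 : ℝ)) z ∂μ :=
          integral_mono (integrable_of_norm_le_one hΘm hΘ).norm hindint hΘA
      _ = μ.real A := by rw [integral_indicator hA]; simp
  · have hprod : ∀ z, (starRingEnd ℂ) (Θ z) * F z = ((A.indicator (fun z => ‖F z‖) z : ℝ) : ℂ) := by
      intro z
      by_cases hz : z ∈ A
      · rw [hΘdef, Set.indicator_of_mem hz, Set.indicator_of_mem hz, map_div₀, Complex.conj_ofReal,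
          div_mul_eq_mul_div, Complex.conj_mul']
        rcases eq_or_ne ‖F z‖ 0 with h0 | h0
        · simp [h0]
        · have : (‖F z‖ : ℂ) ≠ 0 := by exact_mod_cast h0
          field_simp
      · rw [hΘdef, Set.indicator_of_notMem hz, Set.indicator_of_notMem hz]
        simp
    have hFb : ∀ z, ‖F z‖ ≤ ∑ i ∈ S, ‖c i‖ := fun z =>
      (norm_sum_le _ _).trans (Finset.sum_le_sum fun i _ => by rw [norm_mul, he, mul_one])
    have hFint : Integrable (fun z => ‖F z‖) μ :=
      Integrable.of_bound hFm.norm.aestronglyMeasurable (∑ i ∈ S, ‖c i‖)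
        (Filter.Eventually.of_forall fun z => by rw [norm_norm]; exact hFb z)
    have h1 : lam * μ.real A ≤ ∫ z, A.indicator (fun z => ‖F z‖) z ∂μ := by
      calc lam * μ.real A = ∫ z, lam * A.indicator (fun _ => (1 : ℝ)) z ∂μ := by
            rw [integral_const_mul, integral_indicator hA]; simp
        _ ≤ _ := by
            refine integral_mono (hindint.const_mul lam) (hFint.indicator hA) fun z => ?_
            by_cases hz : z ∈ A
            · simp only [Set.indicator_of_mem hz, mul_one]
              exact hF z hz
            · simp [Set.indicator_of_notMem hz]
    have h2 : ((∫ z, A.indicator (fun z => ‖F z‖) z ∂μ : ℝ) : ℂ) =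
        ∑ i ∈ S, c i * (starRingEnd ℂ) (coeffWith μ Θ (e i)) := by
      rw [← integral_complex_ofReal]
      simp_rw [← hprod, hFdef, Finset.mul_sum]
      rw [integral_finsetSum]
      · refine Finset.sum_congr rfl fun i _ => ?_
        rw [coeffWith, ← integral_conj, ← integral_const_mul]
        congr 1
        ext z
        simp
        ring
      · intro i _
        refine Integrable.of_bound (C := ‖c i‖) ?_ (Filter.Eventually.of_forall fun z => ?_)
        · exact ((Complex.continuous_conj.measurable.comp hΘm).mul
            ((hem i).const_mul _)).aestronglyMeasurable
        · rw [norm_mul, RCLike.norm_conj, norm_mul, he, mul_one]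
          exact mul_le_of_le_one_left (norm_nonneg _) (hΘ z)
    have h3 : lam * μ.real A ≤ ∑ i ∈ S, ‖c i‖ * ‖coeffWith μ Θ (e i)‖ := by
      refine h1.trans ?_
      have := congrArg norm h2
      rw [Complex.norm_real] at this
      refine (le_abs_self _).trans (this.le.trans ((norm_sum_le _ _).trans (le_of_eq ?_)))
      refine Finset.sum_congr rfl fun i _ => ?_
      rw [norm_mul, RCLike.norm_conj]
    have h4 := Finset.sum_mul_sq_le_sq_mul_sq S (fun i => ‖c i‖) fun i => ‖coeffWith μ Θ (e i)‖
    calc lam ^ 2 * μ.real A ^ 2 = (lam * μ.real A) ^ 2 := by ring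
      _ ≤ (∑ i ∈ S, ‖c i‖ * ‖coeffWith μ Θ (e i)‖) ^ 2 := by gcongr
      _ ≤ _ := h4
      _ ≤ 1 * ∑ i ∈ S, ‖coeffWith μ Θ (e i)‖ ^ 2 := by
          gcongr
      _ = _ := one_mul _

end TTStar

/-- This splits a quantity at height D: a value above D is smaller than its (s + 1)-st power after
normalisation by D, so the excess is charged to a high moment. -/
lemma le_add_mul_pow {D x : ℝ} (hD : 0 < D) (hx : 0 ≤ x) (s : ℕ) :
    x ≤ D + D * (x / D) ^ (s + 1) := by
  rcases le_total x D with h | h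
  · have : 0 ≤ D * (x / D) ^ (s + 1) := by positivity
    linarith
  · have h1 : 1 ≤ x / D := by rwa [le_div_iff₀ hD, one_mul]
    have h2 : x / D ≤ (x / D) ^ (s + 1) := le_self_pow₀ h1 (Nat.succ_ne_zero s)
    have h3 : x = D * (x / D) := by field_simp
    nlinarith

/-- Level set estimate for an orthonormal system indexed by `ν × ℤ`, in terms of a multiplier with
coefficients `L` on `ℤ`: `B` bounds the kernel of `1 - L`, and `L` is split at height `D`. -/
theorem level_set_bound_of_multiplier {α ν : Type*} [MeasurableSpace α] {μ : Measure α}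
    [IsProbabilityMeasure μ] [Countable ν] {e : ν × ℤ → α → ℂ} (hem : ∀ i, Measurable (e i))
    (he : ∀ i z, ‖e i z‖ = 1)
    (hort : ∀ i j, i ≠ j → ∫ z, (starRingEnd ℂ) (e i z) * e j z ∂μ = 0)
    {w : ν → ℝ} (hw0 : ∀ n, 0 ≤ w n) (hw1 : ∀ n, w n ≤ 1) (hws : Summable w) {W : ℝ}
    (hW : ∑' n, w n ≤ W) {L : ℤ → ℂ} (hL : Summable fun k => ‖L k‖) (hL0 : ‖L 0‖ ≤ 1 / 2)
    {s : ℕ} {S : ℝ} (hS : ∀ F : Finset ℤ, 0 ∉ F → ∑ k ∈ F, ‖L k‖ ^ (s + 1) ≤ S) {B : ℝ}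
    (hB : ∀ z z', ‖∑' p : ν × ℤ, (w p.1 * ((if p.2 = 0 then 1 else 0) - L p.2)) *
      ((starRingEnd ℂ) (e p z) * e p z')‖ ≤ B)
    (J : Finset ν) (c : ν → ℂ) (hc : ∑ n ∈ J, ‖c n‖ ^ 2 ≤ 1) {w₀ : ℝ} (hw₀ : ∀ n ∈ J, w₀ ≤ w n)
    (hw₀' : 0 ≤ w₀)
    {A : Set α} (hA : MeasurableSet A) {lam : ℝ} (hlam : 0 ≤ lam)
    (hF : ∀ z ∈ A, lam ≤ ‖∑ n ∈ J, c n * e (n, 0) z‖) {D : ℝ} (hD : 0 < D) :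
    w₀ * lam ^ 2 * μ.real A ^ 2 ≤
      2 * (B * μ.real A ^ 2 + (D * μ.real A +
        D * (1 / D) ^ (s + 1) * (W * S) * μ.real A ^ 2)) := by
  classical
  set m := μ.real A with hm
  have hm0 : 0 ≤ m := measureReal_nonneg
  obtain ⟨Θ, hΘm, hΘ, hΘ1, hdual⟩ := exists_dual_function (μ := μ) (e := fun n : ν => e (n, 0))
    (fun n => hem _) (fun n => he _) J c hc hA hlam hF
  have hΘ0 : 0 ≤ ∫ z, ‖Θ z‖ ∂μ := integral_nonneg fun _ => norm_nonneg _
  set g : ν × ℤ → ℝ := fun p => ‖coeffWith μ Θ (e p)‖ ^ 2 with hg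
  have hg0 : ∀ p, 0 ≤ g p := fun p => by positivity
  have hgm : ∀ p, g p ≤ m ^ 2 := fun p => by
    simp only [hg]
    gcongr
    exact (norm_coeffWith_le (he p)).trans hΘ1
  have hbes : ∀ P : Finset (ν × ℤ), ∑ p ∈ P, g p ≤ m := fun P =>
    (sum_norm_coeffWith_sq_le hem he hort measure_univ hΘm hΘ P).trans hΘ1
  have hW0 : 0 ≤ W := (tsum_nonneg hw0).trans hW
  have hδ : Summable fun k : ℤ => ‖(if k = 0 then 1 else 0 : ℂ) - L k‖ := by
    have h : Summable fun k : ℤ => ‖(if k = 0 then 1 else 0 : ℂ)‖ :=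
      summable_of_ne_finset_zero (s := {0}) fun k hk => by
        rw [if_neg (by simpa using hk), norm_zero]
    exact (h.add hL).of_nonneg_of_le (fun _ => norm_nonneg _) fun k => norm_sub_le _ _
  set a : ν × ℤ → ℂ := fun p => w p.1 * ((if p.2 = 0 then 1 else 0) - L p.2) with ha
  have has : Summable fun p => ‖a p‖ := by
    refine (hws.mul_of_nonneg hδ hw0 fun _ => norm_nonneg _).congr fun p => ?_
    simp only [ha, norm_mul, Complex.norm_real, Real.norm_of_nonneg (hw0 p.1)]
  have hB0 : 0 ≤ B := by
    obtain ⟨z⟩ : Nonempty α := by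
      by_contra h
      rw [not_nonempty_iff] at h
      have := measure_univ (μ := μ)
      rw [Set.eq_empty_of_isEmpty Set.univ, measure_empty] at this
      exact zero_ne_one this
    exact (norm_nonneg _).trans (hB z z)
  have hTT := (norm_tsum_mul_coeffWith_sq_le hem he has hΘm hΘ hB).trans
    (mul_le_mul_of_nonneg_left (pow_le_pow_left₀ hΘ0 hΘ1 2) hB0)
  set h : ν × ℤ → ℂ := fun p => a p * (g p : ℂ) with hh
  have hhs : Summable fun p => ‖h p‖ := by
    refine (has.mul_right (m ^ 2)).of_nonneg_of_le (fun _ => norm_nonneg _) fun p => ?_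
    simp only [hh, norm_mul, Complex.norm_real, Real.norm_of_nonneg (hg0 p)]
    gcongr
    exact hgm p
  -- The terms with k = 0 form 1 - L 0 times the weighted duality sum `V`, which is to be estimated;
  -- those with k ≠ 0 are the error.
  set u : ν × ℤ → ℂ := fun p => if p.2 = 0 then h p else 0 with hu
  set v : ν × ℤ → ℂ := fun p => if p.2 = 0 then 0 else h p with hv
  have hus : Summable u := Summable.of_norm (hhs.of_nonneg_of_le (fun _ => norm_nonneg _) fun p => by
    simp only [hu]; split_ifs <;> simp)
  have hvs : Summable fun p => ‖v p‖ := hhs.of_nonneg_of_le (fun _ => norm_nonneg _) fun p => by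
    simp only [hv]; split_ifs <;> simp
  have huv : ∑' p, h p = ∑' p, u p + ∑' p, v p := by
    rw [← hus.tsum_add hvs.of_norm]
    refine tsum_congr fun p => ?_
    simp only [hu, hv]
    split_ifs <;> simp
  set V : ℝ := ∑' n, w n * g (n, 0) with hV
  have hVs : Summable fun n => w n * g (n, 0) :=
    (hws.mul_right (m ^ 2)).of_nonneg_of_le (fun n => mul_nonneg (hw0 n) (hg0 _)) fun n => by
      have := hw0 n
      gcongr
      exact hgm _
  have hV0 : 0 ≤ V := tsum_nonneg fun n => mul_nonneg (hw0 n) (hg0 _)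
  have hu_eq : ∑' p, u p = (1 - L 0) * (V : ℂ) := by
    rw [hus.tsum_prod, hV, Complex.ofReal_tsum, ← tsum_mul_left]
    refine tsum_congr fun n => ?_
    rw [tsum_eq_single 0 fun k hk => by simp [hu, hk]]
    simp only [hu, hh, ha, if_true]
    push_cast
    ring
  have hv_le : ‖∑' p, v p‖ ≤ D * m + D * (1 / D) ^ (s + 1) * (W * S) * m ^ 2 := by
    refine (norm_tsum_le_tsum_norm hvs).trans (hvs.tsum_le_of_sum_le fun P => ?_)
    -- Below height D the weight is bounded by 1 and Bessel sums g; above it g is bounded by m² and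
    -- the moments of L are summed.
    have hterm : ∀ p ∈ P, ‖v p‖ ≤ D * g p + D * (1 / D) ^ (s + 1) * m ^ 2 *
        (w p.1 * if p.2 = 0 then 0 else ‖L p.2‖ ^ (s + 1)) := by
      intro p _
      by_cases hp : p.2 = 0
      · simp only [hv, hp, if_true, norm_zero, mul_zero, add_zero]
        exact mul_nonneg hD.le (hg0 p)
      · simp only [hv, hp, if_false, hh, ha, zero_sub, norm_mul, norm_neg, Complex.norm_real,
          Real.norm_of_nonneg (hg0 p), Real.norm_of_nonneg (hw0 p.1)]
        have h1 := le_add_mul_pow hD (norm_nonneg (L p.2)) s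
        have h2 := hw0 p.1
        have h3 := hg0 p
        calc w p.1 * ‖L p.2‖ * g p ≤ w p.1 * (D + D * (‖L p.2‖ / D) ^ (s + 1)) * g p := by gcongr
          _ = w p.1 * (D * g p) + D * (1 / D) ^ (s + 1) * g p * (w p.1 * ‖L p.2‖ ^ (s + 1)) := by
            rw [div_eq_mul_one_div ‖L p.2‖ D, mul_pow]; ring
          _ ≤ 1 * (D * g p) + D * (1 / D) ^ (s + 1) * m ^ 2 * (w p.1 * ‖L p.2‖ ^ (s + 1)) := by
            gcongr
            · exact hw1 _
            · exact hgm p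
          _ = _ := by rw [one_mul]
    have hWS : ∑ p ∈ P, (w p.1 * if p.2 = 0 then 0 else ‖L p.2‖ ^ (s + 1)) ≤ W * S := by
      calc _ ≤ ∑ p ∈ P.image Prod.fst ×ˢ P.image Prod.snd,
            (w p.1 * if p.2 = 0 then 0 else ‖L p.2‖ ^ (s + 1)) := by
            refine Finset.sum_le_sum_of_subset_of_nonneg Finset.subset_product fun p _ _ => ?_
            exact mul_nonneg (hw0 _) (by split_ifs <;> positivity)
        _ = (∑ n ∈ P.image Prod.fst, w n) *
            ∑ k ∈ P.image Prod.snd, (if k = 0 then 0 else ‖L k‖ ^ (s + 1)) := by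
            rw [Finset.sum_product, Finset.sum_mul_sum]
        _ ≤ W * S := by
            gcongr
            · exact (hws.sum_le_tsum _ fun n _ => hw0 n).trans hW
            · have := hS ((P.image Prod.snd).filter (· ≠ 0)) (by simp)
              rw [Finset.sum_filter] at this
              refine le_trans (le_of_eq (Finset.sum_congr rfl fun k _ => ?_)) this
              by_cases hk : k = 0 <;> simp [hk]
    calc _ ≤ ∑ p ∈ P, (D * g p + D * (1 / D) ^ (s + 1) * m ^ 2 *
          (w p.1 * if p.2 = 0 then 0 else ‖L p.2‖ ^ (s + 1))) := Finset.sum_le_sum hterm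
      _ = D * ∑ p ∈ P, g p + D * (1 / D) ^ (s + 1) * m ^ 2 *
          ∑ p ∈ P, (w p.1 * if p.2 = 0 then 0 else ‖L p.2‖ ^ (s + 1)) := by
          rw [Finset.sum_add_distrib, Finset.mul_sum, Finset.mul_sum]
      _ ≤ D * m + D * (1 / D) ^ (s + 1) * m ^ 2 * (W * S) := by
          gcongr
          exact hbes P
      _ = _ := by ring
  have hVle : 1 / 2 * V ≤ B * m ^ 2 + (D * m + D * (1 / D) ^ (s + 1) * (W * S) * m ^ 2) := by
    have h1 : (1 / 2 : ℝ) ≤ ‖1 - L 0‖ := by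
      have := norm_sub_norm_le 1 (L 0)
      rw [norm_one] at this
      linarith
    calc 1 / 2 * V ≤ ‖1 - L 0‖ * V := by gcongr
      _ = ‖∑' p, u p‖ := by rw [hu_eq, norm_mul, Complex.norm_real, Real.norm_of_nonneg hV0]
      _ = ‖∑' p, h p - ∑' p, v p‖ := by rw [huv, add_sub_cancel_right]
      _ ≤ ‖∑' p, h p‖ + ‖∑' p, v p‖ := norm_sub_le _ _
      _ ≤ _ := add_le_add hTT hv_le
  have hdualV : w₀ * (lam ^ 2 * m ^ 2) ≤ V := by
    calc w₀ * (lam ^ 2 * m ^ 2) ≤ w₀ * ∑ n ∈ J, g (n, 0) := by gcongr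
      _ = ∑ n ∈ J, w₀ * g (n, 0) := by rw [Finset.mul_sum]
      _ ≤ ∑ n ∈ J, w n * g (n, 0) :=
          Finset.sum_le_sum fun n hn => mul_le_mul_of_nonneg_right (hw₀ n hn) (hg0 _)
      _ ≤ V := hVs.sum_le_tsum _ fun n _ => mul_nonneg (hw0 n) (hg0 _)
  rw [mul_assoc]
  linarith

/-! ### The orthonormal system of space-time exponentials -/

/-- The series is finite because the Fourier coefficients of the polynomial, read off in the Hilbert
basis `UnitAddTorus.mFourierBasis`, vanish off the box. -/
lemma schrodingerEvolution_trigPoly {d : ℕ} (θ : Fin d → ℝ) (N : ℕ) (c : (Fin d → ℤ) → ℂ)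
    (x : UnitAddTorus (Fin d)) (t : ℝ) :
    schrodingerEvolution θ (trigPoly N c) x t = ∑ n ∈ freqBox d N,
      c n * (UnitAddTorus.mFourier n x * expi (quadForm θ n * t)) := by
  set F : C(UnitAddTorus (Fin d), ℂ) := ∑ n ∈ freqBox d N, c n • UnitAddTorus.mFourier n with hF
  have hcoe : trigPoly N c = F := by
    ext y
    simp [trigPoly, hF]
  have hcoeff : ∀ n, UnitAddTorus.mFourierCoeff (trigPoly N c) n =
      if n ∈ freqBox d N then c n else 0 := by
    intro n
    rw [hcoe, ← UnitAddTorus.mFourierCoeff_toLp, ← UnitAddTorus.mFourierBasis_repr, hF, map_sum,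
      map_sum]
    have h : ∀ m, UnitAddTorus.mFourierBasis.repr (UnitAddTorus.mFourierLp 2 m) =
        lp.single 2 (m : Fin d → ℤ) (1 : ℂ) := by
      intro m
      rw [← UnitAddTorus.coe_mFourierBasis]
      exact UnitAddTorus.mFourierBasis.repr_self m
    simp only [map_smul, h]
    rw [lp.coeFn_sum, Finset.sum_apply]
    simp [Pi.single_apply]
  unfold schrodingerEvolution
  rw [tsum_eq_sum (s := freqBox d N) fun n hn => by rw [hcoeff, if_neg hn, zero_mul]]
  refine Finset.sum_congr rfl fun n hn => ?_
  rw [hcoeff, if_pos hn, expi]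

/-- The exponentials `e(n·x + (Q(n) + k)t)`. -/
def stExp {d : ℕ} (θ : Fin d → ℝ) (p : (Fin d → ℤ) × ℤ) (z : UnitAddTorus (Fin d) × ℝ) : ℂ :=
  UnitAddTorus.mFourier p.1 z.1 * expi ((quadForm θ p.1 + p.2) * z.2)

lemma continuous_stExp {d : ℕ} (θ : Fin d → ℝ) (p : (Fin d → ℤ) × ℤ) :
    Continuous (stExp θ p) := by
  have h1 : Continuous fun z : UnitAddTorus (Fin d) × ℝ => UnitAddTorus.mFourier p.1 z.1 :=
    (UnitAddTorus.mFourier p.1).continuous.comp continuous_fst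
  exact h1.mul (continuous_expi.comp (continuous_const.mul continuous_snd))

lemma mFourier_coe {d : ℕ} (n : Fin d → ℤ) (y : Fin d → ℝ) :
    UnitAddTorus.mFourier n (fun j => (y j : UnitAddCircle)) = expi (∑ j, n j * y j) := by
  have h : ∀ s : Finset (Fin d), expi (∑ j ∈ s, n j * y j) = ∏ j ∈ s, expi (n j * y j) := by
    intro s
    induction s using Finset.cons_induction with
    | empty => simp [expi_zero]
    | cons a s ha ih => rw [Finset.sum_cons, Finset.prod_cons, expi_add, ih]
  rw [h]
  change ∏ j, fourier (n j) (y j : UnitAddCircle) = _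
  refine Finset.prod_congr rfl fun j _ => ?_
  rw [fourier_coe_apply, expi]
  push_cast
  congr 1
  ring

lemma stExp_coe {d : ℕ} (θ : Fin d → ℝ) (p : (Fin d → ℤ) × ℤ) (y : Fin d → ℝ) (t : ℝ) :
    stExp θ p (fun j => (y j : UnitAddCircle), t) = expi (phase θ p.1 y t + p.2 * t) := by
  rw [stExp, mFourier_coe, ← expi_add, phase]
  congr 1
  ring

lemma exists_real_lift {d : ℕ} (x : UnitAddTorus (Fin d)) :
    ∃ y : Fin d → ℝ, x = fun j => (y j : UnitAddCircle) := by
  choose y hy using fun j => QuotientAddGroup.mk_surjective (x j)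
  exact ⟨y, funext fun j => (hy j).symm⟩

lemma norm_stExp {d : ℕ} (θ : Fin d → ℝ) (p : (Fin d → ℤ) × ℤ) (z : UnitAddTorus (Fin d) × ℝ) :
    ‖stExp θ p z‖ = 1 := by
  obtain ⟨x, t⟩ := z
  obtain ⟨y, rfl⟩ := exists_real_lift x
  rw [stExp_coe, norm_expi]

/-- The kernel depends only on the difference z' - z, so a bound uniform in one real point (y, t)
suffices. -/
lemma exists_conj_stExp_mul {d : ℕ} (θ : Fin d → ℝ) (z z' : UnitAddTorus (Fin d) × ℝ) :
    ∃ (y : Fin d → ℝ) (t : ℝ), ∀ p, (starRingEnd ℂ) (stExp θ p z) * stExp θ p z' =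
      expi (phase θ p.1 y t + p.2 * t) := by
  obtain ⟨x, t⟩ := z
  obtain ⟨x', t'⟩ := z'
  obtain ⟨y, rfl⟩ := exists_real_lift x
  obtain ⟨y', rfl⟩ := exists_real_lift x'
  refine ⟨fun j => y' j - y j, t' - t, fun p => ?_⟩
  rw [stExp_coe, stExp_coe, ← expi_neg, ← expi_add]
  congr 1
  simp only [phase, mul_sub, Finset.sum_sub_distrib]
  ring

lemma volume_unitAddCircle_univ : (volume : Measure UnitAddCircle) Set.univ = 1 := by
  rw [AddCircle.measure_univ, ENNReal.ofReal_one]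

lemma isProbabilityMeasure_torus (d : ℕ) :
    IsProbabilityMeasure (volume : Measure (UnitAddTorus (Fin d))) := by
  have : IsProbabilityMeasure (volume : Measure UnitAddCircle) := ⟨volume_unitAddCircle_univ⟩
  exact inferInstanceAs (IsProbabilityMeasure (Measure.pi fun _ : Fin d =>
    (volume : Measure UnitAddCircle)))

lemma integral_fourier_eq_zero {k : ℤ} (hk : k ≠ 0) : ∫ x : UnitAddCircle, fourier k x = 0 :=
  integral_eq_zero_of_add_right_eq_neg (μ := (volume : Measure UnitAddCircle))
    (fourier_add_half_inv_index hk Fact.out)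

lemma integral_mFourier_eq_zero {d : ℕ} {n : Fin d → ℤ} (hn : n ≠ 0) :
    ∫ x : UnitAddTorus (Fin d), UnitAddTorus.mFourier n x = 0 := by
  obtain ⟨i, hi⟩ := Function.ne_iff.1 hn
  change ∫ x : Fin d → UnitAddCircle, ∏ j, fourier (n j) (x j) = 0
  rw [MeasureTheory.integral_fintype_prod_volume_eq_prod (fun j => (fourier (n j) : _ → ℂ))]
  exact Finset.prod_eq_zero (Finset.mem_univ i) (integral_fourier_eq_zero hi)

lemma integral_expi_int_eq_zero (a : ℝ) {k : ℤ} (hk : k ≠ 0) :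
    ∫ t in Set.Ioc a (a + 1), expi (k * t) = 0 := by
  rw [← intervalIntegral.integral_of_le (by linarith)]
  have hc : (2 * π * Complex.I * k : ℂ) ≠ 0 :=
    mul_ne_zero Complex.two_pi_I_ne_zero (by exact_mod_cast hk)
  have h1 : ∀ t : ℝ, expi (k * t) = Complex.exp ((2 * π * Complex.I * k) * t) := by
    intro t
    rw [expi]
    push_cast
    ring_nf
  have h2 : expi (k * (a + 1)) = expi (k * a) := by
    rw [mul_add, mul_one, expi_add, expi_int, mul_one]
  simp_rw [h1]
  rw [integral_exp_mul_complex hc, ← h1, ← h1, h2, sub_self, zero_div]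

/-- Lebesgue measure on `𝕋ᵈ × (a, a + 1]`. -/
def slabMeasure (d : ℕ) (a : ℝ) : Measure (UnitAddTorus (Fin d) × ℝ) :=
  (volume : Measure (UnitAddTorus (Fin d))).prod (volume.restrict (Set.Ioc a (a + 1)))

lemma isProbabilityMeasure_slab (d : ℕ) (a : ℝ) : IsProbabilityMeasure (slabMeasure d a) := by
  have h1 := isProbabilityMeasure_torus d
  have h2 : IsProbabilityMeasure ((volume : Measure ℝ).restrict (Set.Ioc a (a + 1))) :=
    ⟨by simp⟩
  unfold slabMeasure
  infer_instance

lemma slabMeasure_eq (d : ℕ) (a : ℝ) : slabMeasure d a =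
    (volume : Measure (UnitAddTorus (Fin d) × ℝ)).restrict (Set.univ ×ˢ Set.Ioc a (a + 1)) := by
  have h1 := isProbabilityMeasure_torus d
  rw [slabMeasure, Measure.volume_eq_prod, ← Measure.prod_restrict, Measure.restrict_univ]

/-- Orthogonality of the space-time exponentials on a slab of unit height. -/
lemma integral_conj_stExp_mul {d : ℕ} (θ : Fin d → ℝ) (a : ℝ) {p p' : (Fin d → ℤ) × ℤ}
    (hp : p ≠ p') :
    ∫ z, (starRingEnd ℂ) (stExp θ p z) * stExp θ p' z ∂(slabMeasure d a) = 0 := by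
  have h1 := isProbabilityMeasure_torus d
  have h : ∀ z : UnitAddTorus (Fin d) × ℝ, (starRingEnd ℂ) (stExp θ p z) * stExp θ p' z =
      UnitAddTorus.mFourier (-p.1 + p'.1) z.1 *
        expi (-((quadForm θ p.1 + p.2) * z.2) + (quadForm θ p'.1 + p'.2) * z.2) := by
    intro z
    rw [stExp, stExp, map_mul, UnitAddTorus.mFourier_add, UnitAddTorus.mFourier_neg, expi_add,
      expi_neg]
    ring
  simp_rw [h]
  rw [slabMeasure, integral_prod_mul (fun x => UnitAddTorus.mFourier (-p.1 + p'.1) x)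
    (fun t : ℝ => expi (-((quadForm θ p.1 + p.2) * t) + (quadForm θ p'.1 + p'.2) * t))]
  -- For equal spatial frequencies the values of Q cancel and an integer time frequency remains; for
  -- different ones the spatial integral vanishes and the time frequency is irrelevant.
  by_cases hn : p.1 = p'.1
  · have hk : p'.2 - p.2 ≠ 0 := by
      intro h0
      exact hp (Prod.ext hn (by omega))
    have : ∀ t : ℝ, -((quadForm θ p.1 + p.2) * t) + (quadForm θ p'.1 + p'.2) * t =
        ((p'.2 - p.2 : ℤ) : ℝ) * t := by
      intro t
      rw [hn]
      push_cast
      ring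
    simp_rw [this]
    rw [integral_expi_int_eq_zero a hk, mul_zero]
  · rw [integral_mFourier_eq_zero, zero_mul]
    intro h0
    apply hn
    rwa [neg_add_eq_zero] at h0

/-! ### Level sets on a slab of unit height -/

/-- Moments of the Fourier coefficients of the major arc multiplier. -/
lemma exists_sum_norm_arcCoeff_pow_le (s : ℕ) :
    ∃ C : ℝ, 0 < C ∧ ∀ Q : ℕ, 1 ≤ Q → ∀ X : ℝ, 0 < X → ∀ F : Finset ℤ, 0 ∉ F →
      ∑ k ∈ F, ‖arcCoeff Q X k‖ ^ (s + 1) ≤ C * (Q : ℝ) ^ (s + 2) / X ^ s := by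
  -- The divisor moments lose Q^{1/2} and, since δ(s + 1) = 1/2, the logarithms lose another
  -- Q^{1/2}; together they account for the exponent s + 2.
  obtain ⟨C, hC, hmom⟩ := exists_sum_divCount_pow_le (s + 1) (δ := 1 / 2) (by norm_num)
  set δ : ℝ := 1 / (2 * (s + 1)) with hδ
  have hδ0 : 0 < δ := by positivity
  refine ⟨(3 * (1 + 1 / δ)) ^ (s + 1) * C, by positivity, fun Q hQ X hX F hF => ?_⟩
  have hQ1 : (1 : ℝ) ≤ Q := by exact_mod_cast hQ
  have hQ0 : (0 : ℝ) < Q := by linarith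
  have hlog := one_add_log_le_rpow hδ0 hQ
  have hlog0 : 0 ≤ 1 + Real.log Q := by have := Real.log_nonneg hQ1; linarith
  calc _ ≤ ∑ k ∈ F, (3 * (Q / X) * ((1 + 1 / δ) * (Q : ℝ) ^ δ)) ^ (s + 1) *
        (min 1 ((X / (k : ℝ)) ^ 2) * (divCount Q k.natAbs : ℝ) ^ (s + 1)) := by
        refine Finset.sum_le_sum fun k hk => ?_
        have hk0 : k ≠ 0 := fun h => hF (h ▸ hk)
        have hmin : 0 ≤ min 1 ((X / (k : ℝ)) ^ 2) := by positivity
        calc _ ≤ (3 * (Q / X) * (1 + Real.log Q) *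
              (min 1 ((X / (k : ℝ)) ^ 2) * divCount Q k.natAbs)) ^ (s + 1) := by
              gcongr; exact norm_arcCoeff_le hX hk0
          _ = (3 * (Q / X) * (1 + Real.log Q)) ^ (s + 1) *
              (min 1 ((X / (k : ℝ)) ^ 2) ^ (s + 1) * (divCount Q k.natAbs : ℝ) ^ (s + 1)) := by
              rw [mul_pow, mul_pow (min _ _)]
          _ ≤ _ := by
              gcongr
              exact pow_le_of_le_one hmin (min_le_left _ _) (Nat.succ_ne_zero s)
    _ = (3 * (Q / X) * ((1 + 1 / δ) * (Q : ℝ) ^ δ)) ^ (s + 1) *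
        ∑ k ∈ F, min 1 ((X / (k : ℝ)) ^ 2) * (divCount Q k.natAbs : ℝ) ^ (s + 1) := by
        rw [Finset.mul_sum]
    _ ≤ (3 * (Q / X) * ((1 + 1 / δ) * (Q : ℝ) ^ δ)) ^ (s + 1) * (C * (Q : ℝ) ^ (1 / 2 : ℝ) * X) := by
        gcongr
        exact hmom Q hQ X hX F hF
    _ = (3 * (1 + 1 / δ)) ^ (s + 1) * C * ((Q : ℝ) ^ (s + 1) *
        (((Q : ℝ) ^ δ) ^ (s + 1) * (Q : ℝ) ^ (1 / 2 : ℝ))) * (X / X ^ (s + 1)) := by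
        rw [mul_pow, mul_pow, mul_pow, mul_pow, div_pow]
        ring
    _ = _ := by
        have h1 : ((Q : ℝ) ^ δ) ^ (s + 1) * (Q : ℝ) ^ (1 / 2 : ℝ) = Q := by
          rw [← Real.rpow_natCast, ← Real.rpow_mul hQ0.le, ← Real.rpow_add hQ0]
          have : δ * ((s + 1 : ℕ) : ℝ) + 1 / 2 = 1 := by
            rw [hδ]; push_cast; field_simp; norm_num
          rw [this, Real.rpow_one]
        have h2 : X / X ^ (s + 1) = 1 / X ^ s := by
          rw [pow_succ]; field_simp
        rw [h1, h2]
        ring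

/-- The set where the evolution of `trigPoly N c` exceeds `lam`. -/
def superlevel {d : ℕ} (θ : Fin d → ℝ) (N : ℕ) (c : (Fin d → ℤ) → ℂ) (lam : ℝ) :
    Set (UnitAddTorus (Fin d) × ℝ) :=
  {p | lam < ‖schrodingerEvolution θ (trigPoly N c) p.1 p.2‖}

lemma schrodingerEvolution_eq_sum_stExp {d : ℕ} (θ : Fin d → ℝ) (N : ℕ) (c : (Fin d → ℤ) → ℂ)
    (z : UnitAddTorus (Fin d) × ℝ) :
    schrodingerEvolution θ (trigPoly N c) z.1 z.2 =
      ∑ n ∈ freqBox d N, c n * stExp θ (n, 0) z := by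
  rw [schrodingerEvolution_trigPoly]
  simp [stExp]

lemma measurableSet_superlevel {d : ℕ} (θ : Fin d → ℝ) (N : ℕ) (c : (Fin d → ℤ) → ℂ) (lam : ℝ) :
    MeasurableSet (superlevel θ N c lam) := by
  unfold superlevel
  simp_rw [schrodingerEvolution_eq_sum_stExp]
  refine (isOpen_lt continuous_const ?_).measurableSet
  exact (continuous_finsetSum _ fun n _ => continuous_const.mul (continuous_stExp θ (n, 0))).norm

/-- Cauchy–Schwarz over the at most (3N)^d frequencies of the box; level sets above this height are
empty. -/
lemma sq_norm_schrodingerEvolution_le {d : ℕ} (θ : Fin d → ℝ) {N : ℕ} (hN : 1 ≤ N)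
    {c : (Fin d → ℤ) → ℂ} (hc : ∑ n ∈ freqBox d N, ‖c n‖ ^ 2 = 1) (z : UnitAddTorus (Fin d) × ℝ) :
    ‖schrodingerEvolution θ (trigPoly N c) z.1 z.2‖ ^ 2 ≤ 3 ^ d * (N : ℝ) ^ d := by
  rw [schrodingerEvolution_eq_sum_stExp]
  have h1 : ‖∑ n ∈ freqBox d N, c n * stExp θ (n, 0) z‖ ≤ ∑ n ∈ freqBox d N, 1 * ‖c n‖ := by
    refine (norm_sum_le _ _).trans (Finset.sum_le_sum fun n _ => ?_)
    rw [norm_mul, norm_stExp, mul_one, one_mul]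
  have h2 := Finset.sum_mul_sq_le_sq_mul_sq (freqBox d N) (fun _ => (1 : ℝ)) fun n => ‖c n‖
  rw [hc] at h2
  have h3 : ((freqBox d N).card : ℝ) ≤ 3 ^ d * (N : ℝ) ^ d := by
    rw [freqBox, Fintype.card_piFinset, ← mul_pow]
    simp only [Int.card_Icc, Finset.prod_const, Finset.card_univ, Fintype.card_fin]
    push_cast
    gcongr
    have : ((N : ℤ) + 1 - -(N : ℤ)).toNat ≤ 3 * N := by omega
    exact_mod_cast this
  calc _ ≤ (∑ n ∈ freqBox d N, 1 * ‖c n‖) ^ 2 := by gcongr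
    _ ≤ _ := h2
    _ ≤ _ := by simpa using h3

set_option maxHeartbeats 1000000 in
/-- The level set estimate at height `N^{d/2} M^{-1/2}`, for `M²` at most a small multiple
of `N`. -/
lemma exists_measure_superlevel_le (d : ℕ) {η : ℝ} (hη : 0 < η) :
    ∃ b C : ℝ, 0 < b ∧ 0 < C ∧ ∀ θ : Fin (d + 1) → ℝ, θ 0 = 1 → ∀ (a : ℝ) (N : ℕ), 1 ≤ N →
      ∀ c : (Fin (d + 1) → ℤ) → ℂ, ∑ n ∈ freqBox (d + 1) N, ‖c n‖ ^ 2 = 1 →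
      ∀ lam M : ℝ, 0 < lam → 1 ≤ M → (N : ℝ) ^ (d + 1) ≤ lam ^ 2 * M → b * M ^ 2 ≤ N →
        (slabMeasure (d + 1) a).real (superlevel θ N c lam) ≤
          C * (M ^ (2 + η) / ((N : ℝ) ^ 2 * lam ^ 2)) := by
  have hg := one_le_gaussConst
  -- With ηs ≥ 5 the factor D^{-s} absorbs the M⁴ left from Q^{s+2} and supplies the further M^{-1}
  -- needed for comparison with λ².
  set s : ℕ := ⌈5 / η⌉₊ with hs
  have hs1 : 1 ≤ s := Nat.one_le_ceil_iff.2 (by positivity)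
  have hsη : 5 ≤ η * s := by
    have := Nat.le_ceil (5 / η)
    rw [div_le_iff₀ hη] at this
    rw [mul_comm]
    exact this
  obtain ⟨CS, hCS, hS⟩ := exists_sum_norm_arcCoeff_pow_le s
  set G : ℝ := (2 * gaussConst) ^ (d + 1) with hG
  have hG1 : 1 ≤ G := one_le_pow₀ (by linarith)
  set w₀ : ℝ := rexp (-π) ^ (d + 1) with hw₀
  have hw₀0 : 0 < w₀ := by positivity
  have hw₀1 : w₀ ≤ 1 := pow_le_one₀ (Real.exp_pos _).le (by
    rw [Real.exp_le_one_iff]; linarith [Real.pi_pos])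
  -- Makes 32G/(rM) equal to w₀/M, so that with Q ≥ (rM)² the minor arc bound is at most an eighth
  -- of w₀λ².
  set r : ℝ := 32 * G / w₀ with hr
  have hr1 : 1 ≤ r := by
    rw [hr, le_div_iff₀ hw₀0]; linarith
  -- Makes the contribution of the coefficients above height D at most another eighth of w₀λ².
  set E : ℝ := 1 + 8 * G * CS * (2 * r ^ 2) ^ (s + 2) / w₀ with hE
  have hE1 : 1 ≤ E := by
    rw [hE]
    have : 0 ≤ 8 * G * CS * (2 * r ^ 2) ^ (s + 2) / w₀ := by positivity
    linarith
  -- The bound 6r²M² ≤ N gives 3Q ≤ N, hence disjoint arcs and a zeroth coefficient at most 1/2; it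
  -- also gives N ≥ (rM)², which controls the √N term.
  refine ⟨6 * r ^ 2, 4 * E / w₀, by positivity, by positivity,
    fun θ hθ a N hN c hc lam M hlam hM hlamM hbM => ?_⟩
  have hN1 : (1 : ℝ) ≤ N := by exact_mod_cast hN
  have hN0 : (0 : ℝ) < N := by linarith
  have hM0 : 0 < M := by linarith
  have hM2 : 1 ≤ M ^ 2 := one_le_pow₀ hM
  set Q : ℕ := ⌈(r * M) ^ 2⌉₊ with hQdef
  have hrM : 1 ≤ (r * M) ^ 2 := one_le_pow₀ (by nlinarith)
  have hQ1 : 1 ≤ Q := Nat.one_le_ceil_iff.2 (by linarith)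
  have hQle : (r * M) ^ 2 ≤ Q := Nat.le_ceil _
  have hQup : (Q : ℝ) ≤ 2 * r ^ 2 * M ^ 2 := by
    have := (Nat.ceil_lt_add_one (by positivity : 0 ≤ (r * M) ^ 2)).le
    calc (Q : ℝ) ≤ (r * M) ^ 2 + 1 := this
      _ ≤ (r * M) ^ 2 + (r * M) ^ 2 := by gcongr
      _ = _ := by ring
  have hQN : 3 * (Q : ℝ) ≤ N := by linarith
  have hX0 : (0 : ℝ) < (N : ℝ) ^ 2 := by positivity
  have hQN2 : 9 * (Q : ℝ) ^ 2 ≤ (N : ℝ) ^ 2 := by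
    have := pow_le_pow_left₀ (by positivity) hQN 2
    nlinarith
  have hX : 4 * (Q : ℝ) ^ 2 ≤ (N : ℝ) ^ 2 := by
    have : 0 ≤ (Q : ℝ) ^ 2 := by positivity
    linarith
  set D : ℝ := E * M ^ (2 + η) / (N : ℝ) ^ 2 with hD
  have hMη : 0 < M ^ (2 + η) := Real.rpow_pos_of_pos hM0 _
  have hD0 : 0 < D := by positivity
  set B : ℝ := (2 * gaussConst * N) ^ d * (4 * gaussConst * (N / √Q + √N)) with hB
  have hprob := isProbabilityMeasure_slab (d + 1) a
  have hL0 : ‖arcCoeff Q ((N : ℝ) ^ 2) 0‖ ≤ 1 / 2 := by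
    refine (norm_arcCoeff_zero_le hX0).trans ?_
    rw [div_le_iff₀ hX0]
    have : 0 ≤ (Q : ℝ) ^ 2 := by positivity
    linarith
  have key := level_set_bound_of_multiplier (μ := slabMeasure (d + 1) a) (e := stExp θ)
    (fun p => (continuous_stExp θ p).measurable) (norm_stExp θ)
    (fun p p' hpp => integral_conj_stExp_mul θ a hpp)
    (w := gaussWeight (1 / (N : ℝ) ^ 2)) (fun n => (gaussWeight_pos _ n).le)
    (gaussWeight_le_one (by positivity)) (summable_gaussWeight (d + 1) (by positivity))
    (tsum_gaussWeight_le (d + 1) hN) (L := arcCoeff Q ((N : ℝ) ^ 2))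
    (summable_norm_arcCoeff hX0) hL0 (s := s) (hS Q hQ1 _ hX0) (B := B)
    (fun z z' => by
      obtain ⟨y, t, h⟩ := exists_conj_stExp_mul θ z z'
      simp_rw [h]
      exact norm_minor_kernel_le hθ hN hQ1 hX y t)
    (freqBox (d + 1) N) c hc.le (w₀ := w₀) (fun n hn => le_gaussWeight_of_mem_freqBox hN hn) hw₀0.le
    (measurableSet_superlevel θ N c lam) hlam.le
    (fun z hz => by rw [← schrodingerEvolution_eq_sum_stExp]; exact le_of_lt hz) hD0
  set m := (slabMeasure (d + 1) a).real (superlevel θ N c lam) with hm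
  have hm0 : 0 ≤ m := measureReal_nonneg
  have hlamN : (N : ℝ) ^ (d + 1) / M ≤ lam ^ 2 := by rwa [div_le_iff₀ hM0]
  have hBle : 8 * B ≤ w₀ * lam ^ 2 := by
    have e1 : B = 2 * G * (N : ℝ) ^ (d + 1) * (1 / √Q + 1 / √N) := by
      have hsq : √(N : ℝ) = N * (1 / √N) := by
        have h3 : 0 < √(N : ℝ) := Real.sqrt_pos.2 hN0
        field_simp
        rw [Real.sq_sqrt hN0.le]
      have hsum : (N : ℝ) / √Q + √N = N * (1 / √Q + 1 / √N) := by
        rw [mul_add, ← hsq]; ring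
      rw [hB, hG, hsum]
      ring
    have e2 : ∀ x : ℝ, (r * M) ^ 2 ≤ x → 1 / √x ≤ 1 / (r * M) := by
      intro x hx
      have : r * M ≤ √x := Real.le_sqrt_of_sq_le hx
      gcongr
    have h1 := e2 Q hQle
    have h2 := e2 N (by nlinarith)
    calc 8 * B = 16 * G * (N : ℝ) ^ (d + 1) * (1 / √Q + 1 / √N) := by rw [e1]; ring
      _ ≤ 16 * G * (N : ℝ) ^ (d + 1) * (1 / (r * M) + 1 / (r * M)) := by gcongr
      _ = w₀ * ((N : ℝ) ^ (d + 1) / M) := by rw [hr]; field_simp; ring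
      _ ≤ _ := by gcongr
  have hSle : 8 * (D * (1 / D) ^ (s + 1) * ((2 * gaussConst * N) ^ (d + 1) *
      (CS * (Q : ℝ) ^ (s + 2) / ((N : ℝ) ^ 2) ^ s))) ≤ w₀ * lam ^ 2 := by
    have hDs : D * (1 / D) ^ (s + 1) = ((N : ℝ) ^ 2) ^ s / (E ^ s * (M ^ (2 + η)) ^ s) := by
      rw [pow_succ, mul_comm, mul_assoc, one_div_mul_cancel hD0.ne', mul_one, hD, one_div_div,
        div_pow, mul_pow]
    have hMs : M ^ (2 * s + 5) ≤ (M ^ (2 + η)) ^ s := by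
      rw [← Real.rpow_natCast M, ← Real.rpow_natCast (M ^ (2 + η)), ← Real.rpow_mul hM0.le]
      apply Real.rpow_le_rpow_of_exponent_le hM
      push_cast
      linarith
    have hEs : E ≤ E ^ s := le_self_pow₀ hE1 (by omega)
    calc _ = 8 * G * (N : ℝ) ^ (d + 1) * CS * (Q : ℝ) ^ (s + 2) / (E ^ s * (M ^ (2 + η)) ^ s) := by
          rw [hDs, hG, mul_pow]
          field_simp
      _ ≤ 8 * G * (N : ℝ) ^ (d + 1) * CS * (2 * r ^ 2 * M ^ 2) ^ (s + 2) /
          (E * M ^ (2 * s + 5)) := by gcongr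
      _ = 8 * G * CS * (2 * r ^ 2) ^ (s + 2) / E * ((N : ℝ) ^ (d + 1) / M) := by
          rw [mul_pow (2 * r ^ 2), ← pow_mul, show M ^ (2 * s + 5) = M ^ (2 * (s + 2)) * M by ring]
          field_simp
      _ ≤ w₀ * ((N : ℝ) ^ (d + 1) / M) := by
          gcongr
          rw [div_le_iff₀ (by linarith), hE, mul_add, mul_one, mul_div_cancel₀ _ hw₀0.ne']
          linarith
      _ ≤ _ := by gcongr
  set Z := D * (1 / D) ^ (s + 1) * ((2 * gaussConst * N) ^ (d + 1) *
      (CS * (Q : ℝ) ^ (s + 2) / ((N : ℝ) ^ 2) ^ s)) with hZ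
  -- The two absorbed terms, doubled, take half of the left side, so only 4Dm remains.
  have hfin : w₀ * lam ^ 2 * m ^ 2 ≤ 4 * D * m := by
    have h1 : 8 * B * m ^ 2 ≤ w₀ * lam ^ 2 * m ^ 2 := by gcongr
    have h2 : 8 * Z * m ^ 2 ≤ w₀ * lam ^ 2 * m ^ 2 := by gcongr
    linarith
  have hgoal : 4 * E / w₀ * (M ^ (2 + η) / ((N : ℝ) ^ 2 * lam ^ 2)) = 4 * D / (w₀ * lam ^ 2) := by
    rw [hD]; ring
  rw [hgoal, le_div_iff₀ (by positivity)]
  rcases hm0.eq_or_lt with h0 | h0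
  · rw [← h0, zero_mul]; positivity
  · have : m * (m * (w₀ * lam ^ 2)) ≤ m * (4 * D) := by linarith
    exact le_of_mul_le_mul_left this h0

lemma volume_levelSet_slab {d : ℕ} (θ : Fin d → ℝ) (N : ℕ) (c : (Fin d → ℤ) → ℂ) (a lam : ℝ) :
    volume (levelSet θ (trigPoly N c) (Set.Ioc a (a + 1)) lam) =
      slabMeasure d a (superlevel θ N c lam) := by
  rw [slabMeasure_eq, Measure.restrict_apply (measurableSet_superlevel θ N c lam)]
  congr 1
  ext p
  simp [levelSet, superlevel, and_comm]

/-- Lossless level set estimate for every exponent `q = 6 + 2η > 6` on a slab of unit height, in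
the range `λ ≥ κ N^{d/2 - 1/4 + ε}`. -/
lemma exists_volume_levelSet_slab_le (d : ℕ) {η ε κ : ℝ} (hη : 0 < η) (hε : 0 < ε) (hκ : 0 < κ) :
    ∃ C : ℝ, 0 < C ∧ ∀ θ : Fin (d + 1) → ℝ, θ 0 = 1 → ∀ (a : ℝ) (N : ℕ), 1 ≤ N →
      ∀ c : (Fin (d + 1) → ℤ) → ℂ, ∑ n ∈ freqBox (d + 1) N, ‖c n‖ ^ 2 = 1 →
      ∀ lam : ℝ, κ * (N : ℝ) ^ (((d : ℝ) + 1) / 2 - 1 / 4 + ε) ≤ lam →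
        volume (levelSet θ (trigPoly N c) (Set.Ioc a (a + 1)) lam) ≤
          ENNReal.ofReal (C * ((N : ℝ) ^ (((d : ℝ) + 1) * (2 + η) - 2) * lam ^ (-(6 + 2 * η)))) := by
  obtain ⟨b, C₁, hb, hC₁, hmain⟩ := exists_measure_superlevel_le d hη
  set T : ℝ := 3 ^ (d + 1) with hT
  have hT0 : 0 < T := by positivity
  set R : ℝ := b * (T / κ ^ 2) ^ 2 with hR
  have hR0 : 0 < R := by positivity
  set N₁ : ℝ := max 1 (R ^ (1 / (4 * ε))) with hN₁
  have hN₁1 : 1 ≤ N₁ := le_max_left _ _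
  set C₂ : ℝ := N₁ ^ 2 * (N₁ ^ ((d : ℝ) + 1)) * T ^ (3 + η) with hC₂
  refine ⟨C₁ * T ^ (2 + η) + C₂, by positivity, fun θ hθ a N hN c hc lam hlam => ?_⟩
  have hN1 : (1 : ℝ) ≤ N := by exact_mod_cast hN
  have hN0 : (0 : ℝ) < N := by linarith
  have hlam0 : 0 < lam := lt_of_lt_of_le (by positivity) hlam
  have hprob := isProbabilityMeasure_slab (d + 1) a
  rw [volume_levelSet_slab]
  rcases (superlevel θ N c lam).eq_empty_or_nonempty with hemp | ⟨z, hz⟩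
  · rw [hemp, measure_empty]; exact zero_le
  have hlam2 : lam ^ 2 ≤ T * (N : ℝ) ^ (d + 1) := by
    refine le_trans ?_ (sq_norm_schrodingerEvolution_le θ hN hc z)
    exact pow_le_pow_left₀ hlam0.le (le_of_lt hz) 2
  have hNd : (N : ℝ) ^ (d + 1) = (N : ℝ) ^ ((d : ℝ) + 1) := by
    rw [← Real.rpow_natCast]; push_cast; rfl
  have hlampow : ∀ x : ℝ, (lam ^ 2) ^ x = lam ^ (2 * x) := fun x => by
    rw [← Real.rpow_natCast, ← Real.rpow_mul hlam0.le]; norm_num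
  set P : ℝ := (N : ℝ) ^ (((d : ℝ) + 1) * (2 + η) - 2) * lam ^ (-(6 + 2 * η)) with hP
  have hP0 : 0 < P := by positivity
  rw [← ofReal_measureReal]
  apply ENNReal.ofReal_le_ofReal
  -- The factor T from Cauchy–Schwarz makes M ≥ 1 as soon as the level set is nonempty.
  set M : ℝ := T * (N : ℝ) ^ (d + 1) / lam ^ 2 with hM
  have hM1 : 1 ≤ M := by rwa [hM, le_div_iff₀ (by positivity), one_mul]
  rcases le_total (b * M ^ 2) N with hcase | hcase
  · have h := hmain θ hθ a N hN c hc lam M hlam0 hM1 (by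
      rw [hM, mul_div_cancel₀ _ (by positivity)]
      exact le_mul_of_one_le_left (by positivity) (one_le_pow₀ (by norm_num))) hcase
    have e : M ^ (2 + η) / ((N : ℝ) ^ 2 * lam ^ 2) = T ^ (2 + η) * P := by
      rw [hM, Real.div_rpow (by positivity) (by positivity),
        Real.mul_rpow (by positivity) (by positivity), hNd, ← Real.rpow_mul hN0.le, hlampow, hP,
        Real.rpow_sub hN0, show -(6 + 2 * η) = -(2 * (2 + η)) - 2 by ring, Real.rpow_sub hlam0,
        Real.rpow_neg hlam0.le]
      norm_num
      field_simp
    rw [e] at h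
    have : 0 ≤ C₂ * P := by positivity
    linarith
  -- Here the lower bound on λ forces N ≤ R N^{1-4ε}, so N ≤ N₁; for such N the constant C₂ makes
  -- the right side exceed the total mass 1 of the slab.
  · have hN4 : (N : ℝ) ≤ R * (N : ℝ) ^ (1 - 4 * ε) := by
      have h1 : M ≤ T / κ ^ 2 * (N : ℝ) ^ (1 / 2 - 2 * ε) := by
        have h2 : κ ^ 2 * (N : ℝ) ^ (2 * (((d : ℝ) + 1) / 2 - 1 / 4 + ε)) ≤ lam ^ 2 := by
          refine le_trans (le_of_eq ?_) (pow_le_pow_left₀ (by positivity) hlam 2)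
          rw [mul_pow, mul_comm 2, Real.rpow_mul hN0.le]
          norm_num
        calc M ≤ T * (N : ℝ) ^ (d + 1) /
              (κ ^ 2 * (N : ℝ) ^ (2 * (((d : ℝ) + 1) / 2 - 1 / 4 + ε))) := by
              rw [hM]; gcongr
          _ = T / κ ^ 2 * ((N : ℝ) ^ ((d : ℝ) + 1) /
              (N : ℝ) ^ (2 * (((d : ℝ) + 1) / 2 - 1 / 4 + ε))) := by
              rw [hNd]; field_simp
          _ = _ := by
              rw [← Real.rpow_sub hN0]
              congr 2
              ring
      calc (N : ℝ) ≤ b * M ^ 2 := hcase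
        _ ≤ b * (T / κ ^ 2 * (N : ℝ) ^ (1 / 2 - 2 * ε)) ^ 2 := by gcongr
        _ = R * ((N : ℝ) ^ (1 / 2 - 2 * ε)) ^ 2 := by rw [hR]; ring
        _ = _ := by
            rw [← Real.rpow_natCast, ← Real.rpow_mul hN0.le]
            congr 2
            push_cast
            ring
    have hNle : (N : ℝ) ≤ N₁ := by
      refine le_trans ?_ (le_max_right _ _)
      have h1 : (N : ℝ) ^ (4 * ε) ≤ R := by
        have h2 : (N : ℝ) ^ (4 * ε) * (N : ℝ) ^ (1 - 4 * ε) = N := by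
          rw [← Real.rpow_add hN0]; simp
        have h3 : 0 < (N : ℝ) ^ (1 - 4 * ε) := by positivity
        exact le_of_mul_le_mul_right (h2.trans_le hN4) h3
      calc (N : ℝ) = ((N : ℝ) ^ (4 * ε)) ^ (1 / (4 * ε)) := by
            rw [← Real.rpow_mul hN0.le, mul_one_div_cancel (by positivity), Real.rpow_one]
        _ ≤ _ := by gcongr
    have h1 : 1 ≤ C₂ * P := by
      have h2 : lam ^ (6 + 2 * η) ≤ T ^ (3 + η) * (N : ℝ) ^ (((d : ℝ) + 1) * (3 + η)) := by
        have h3 := Real.rpow_le_rpow (by positivity) hlam2 (z := 3 + η) (by positivity)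
        rw [hlampow, Real.mul_rpow (by positivity) (by positivity), hNd,
          ← Real.rpow_mul hN0.le] at h3
        convert h3 using 2
        ring
      have e : C₂ * P = N₁ ^ 2 * N₁ ^ ((d : ℝ) + 1) * T ^ (3 + η) *
          (N : ℝ) ^ (((d : ℝ) + 1) * (2 + η) - 2) / lam ^ (6 + 2 * η) := by
        rw [hC₂, hP, Real.rpow_neg hlam0.le]; ring
      rw [e, le_div_iff₀ (by positivity), one_mul]
      refine h2.trans ?_
      calc T ^ (3 + η) * (N : ℝ) ^ (((d : ℝ) + 1) * (3 + η)) =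
            (N : ℝ) ^ 2 * (N : ℝ) ^ ((d : ℝ) + 1) * T ^ (3 + η) *
              (N : ℝ) ^ (((d : ℝ) + 1) * (2 + η) - 2) := by
            rw [show ((d : ℝ) + 1) * (3 + η) = ((2 : ℕ) : ℝ) + ((d : ℝ) + 1) +
              (((d : ℝ) + 1) * (2 + η) - 2) by push_cast; ring, Real.rpow_add hN0,
              Real.rpow_add hN0, Real.rpow_natCast]
            ring
        _ ≤ _ := by gcongr
    have h2 : (slabMeasure (d + 1) a).real (superlevel θ N c lam) ≤ 1 := measureReal_le_one
    have h3 : 0 ≤ C₁ * T ^ (2 + η) * P := by positivity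
    linarith

/-- The same estimate on an arbitrary compact time interval. -/
lemma exists_volume_levelSet_le {d : ℕ} (hd : 0 < d) {q ε ℓ κ : ℝ} (hq : 6 < q) (hε : 0 < ε)
    (hκ : 0 < κ) :
    ∃ C : ℝ, 0 < C ∧ ∀ θ : Fin d → ℝ, θ ⟨0, hd⟩ = 1 → ∀ (a : ℝ) (N : ℕ), 1 ≤ N →
      ∀ c : (Fin d → ℤ) → ℂ, ∑ n ∈ freqBox d N, ‖c n‖ ^ 2 = 1 →
      ∀ lam : ℝ, κ * (N : ℝ) ^ ((d : ℝ) / 2 - 1 / 4 + ε) ≤ lam →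
        volume (levelSet θ (trigPoly N c) (Set.Icc a (a + ℓ)) lam) ≤
          ENNReal.ofReal (C * (N : ℝ) ^ ((d : ℝ) / 2 * q - ((d : ℝ) + 2)) * lam ^ (-q)) := by
  obtain ⟨d, rfl⟩ : ∃ k, d = k + 1 := ⟨d - 1, by omega⟩
  obtain ⟨C, hC, h⟩ := exists_volume_levelSet_slab_le d (η := (q - 6) / 2) (by linarith) hε hκ
  refine ⟨(⌈ℓ⌉₊ + 1 : ℕ) * C, by positivity, fun θ hθ a N hN c hc lam hlam => ?_⟩
  push_cast at hlam
  -- The slabs are open below, so they start at a - 1: the endpoint t = a lies in the one with index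
  -- 0. The bound on each slab does not depend on its position.
  have hcover : levelSet θ (trigPoly N c) (Set.Icc a (a + ℓ)) lam ⊆
      ⋃ i ∈ Finset.range (⌈ℓ⌉₊ + 1),
        levelSet θ (trigPoly N c) (Set.Ioc (a - 1 + i) (a - 1 + i + 1)) lam := by
    rintro ⟨x, t⟩ ⟨⟨h1, h2⟩, h3⟩
    simp only [Set.mem_iUnion, Finset.mem_range]
    refine ⟨⌈t - a⌉₊, Nat.lt_succ_of_le (Nat.ceil_mono (by simp only at h2; linarith)), ⟨?_, ?_⟩, h3⟩
    · have := Nat.ceil_lt_add_one (a := t - a) (by simp only at h1; linarith)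
      simp only
      linarith
    · have := Nat.le_ceil (t - a)
      simp only
      linarith
  have hpos : 0 ≤ C * ((N : ℝ) ^ (((d : ℝ) + 1) * (2 + (q - 6) / 2) - 2) *
      lam ^ (-(6 + 2 * ((q - 6) / 2)))) := by
    have : 0 ≤ lam := le_trans (by positivity) hlam
    positivity
  calc _ ≤ ∑ i ∈ Finset.range (⌈ℓ⌉₊ + 1), volume
        (levelSet θ (trigPoly N c) (Set.Ioc (a - 1 + i) (a - 1 + i + 1)) lam) :=
        (measure_mono hcover).trans (measure_biUnion_finset_le _ _)
    _ ≤ ∑ i ∈ Finset.range (⌈ℓ⌉₊ + 1), ENNReal.ofReal (C *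
        ((N : ℝ) ^ (((d : ℝ) + 1) * (2 + (q - 6) / 2) - 2) *
          lam ^ (-(6 + 2 * ((q - 6) / 2))))) :=
        Finset.sum_le_sum fun i _ => h θ hθ _ N hN c hc lam hlam
    _ = _ := by
        rw [Finset.sum_const, Finset.card_range, ← ENNReal.ofReal_nsmul, nsmul_eq_mul]
        push_cast
        rw [show ((d : ℝ) + 1) * (2 + (q - 6) / 2) - 2 = ((d : ℝ) + 1) / 2 * q - ((d : ℝ) + 1 + 2) by
          ring, show -(6 + 2 * ((q - 6) / 2)) = -q by ring]
        ring_nf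

end IrrationalTorus

end

/-! ### Deduction of the two level set estimates -/

theorem mainTheorem7 (d : ℕ) (hd : 0 < d) :
    (∀ ε : ℝ, 0 < ε → ∀ C₀ : ℝ, 1 ≤ C₀ → ∀ ℓ : ℝ, 0 ≤ ℓ → ∀ κ : ℝ, 0 < κ →
      ∃ C : ℝ, 0 < C ∧
        ∀ θ : Fin d → ℝ, θ ⟨0, hd⟩ = 1 → (∀ j, 1 / C₀ ≤ θ j ∧ θ j ≤ C₀) →
        ∀ (a : ℝ) (N : ℕ), 1 ≤ N →
        ∀ c : (Fin d → ℤ) → ℂ, ∑ n ∈ IrrationalTorus.freqBox d N, ‖c n‖ ^ 2 = 1 →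
        ∀ lam : ℝ, κ * (N : ℝ) ^ ((d : ℝ) / 2 - 1 / 4 + ε) ≤ lam →
          MeasureTheory.volume (IrrationalTorus.levelSet θ (IrrationalTorus.trigPoly N c)
              (Set.Icc a (a + ℓ)) lam)
            ≤ ENNReal.ofReal (C * (N : ℝ) ^ (2 * ((d : ℝ) - 1) * (1 / (1 + 6 * ε)))
                * lam ^ (-6 + 24 / (1 + 6 * ε) * ε))) ∧
    (∀ q : ℝ, 6 < q → ∃ ε : ℝ, 0 < ε ∧
      ∀ C₀ : ℝ, 1 ≤ C₀ → ∀ ℓ : ℝ, 0 ≤ ℓ → ∀ κ : ℝ, 0 < κ →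
      ∃ C : ℝ, 0 < C ∧
        ∀ θ : Fin d → ℝ, θ ⟨0, hd⟩ = 1 → (∀ j, 1 / C₀ ≤ θ j ∧ θ j ≤ C₀) →
        ∀ (a : ℝ) (N : ℕ), 1 ≤ N →
        ∀ c : (Fin d → ℤ) → ℂ, ∑ n ∈ IrrationalTorus.freqBox d N, ‖c n‖ ^ 2 = 1 →
        ∀ lam : ℝ, κ * (N : ℝ) ^ ((d : ℝ) / 2 - ε) ≤ lam →
          MeasureTheory.volume (IrrationalTorus.levelSet θ (IrrationalTorus.trigPoly N c)
              (Set.Icc a (a + ℓ)) lam)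
            ≤ ENNReal.ofReal (C * (N : ℝ) ^ ((d : ℝ) / 2 * q - ((d : ℝ) + 2))
                * lam ^ (-q))) := by
  -- In (ii) the value 1/8 serves every q, since d/2 - 1/8 = d/2 - 1/4 + 1/8 lies in the lossless
  -- range.
  refine ⟨fun ε hε C₀ _ ℓ _ κ hκ => ?_, fun q hq => ⟨1 / 8, by norm_num, fun C₀ _ ℓ _ κ hκ => ?_⟩⟩
  -- The lossless bound at exponent 6 + σ has a surplus factor λ^{-2σ} over the target, converted
  -- into a power of N by the lower bound on λ. Since σ = 4 - 4/(1 + 6ε), the exponent of N becomes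
  -- 2(d - 1)/(1 + 6ε) - 2εσ, slightly better than required.
  · set σ : ℝ := 24 / (1 + 6 * ε) * ε with hσ
    have hσ0 : 0 < σ := by positivity
    obtain ⟨C, hC, h⟩ := IrrationalTorus.exists_volume_levelSet_le hd (q := 6 + σ) (ℓ := ℓ)
      (by linarith) hε hκ
    refine ⟨C * κ ^ (-(2 * σ)), by positivity, fun θ hθ _ a N hN c hc lam hlam => ?_⟩
    refine (h θ hθ a N hN c hc lam hlam).trans (ENNReal.ofReal_le_ofReal ?_)
    have hN1 : (1 : ℝ) ≤ N := by exact_mod_cast hN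
    have hN0 : (0 : ℝ) < N := by linarith
    have hlam0 : 0 < lam := lt_of_lt_of_le (by positivity) hlam
    have h1 : lam ^ (-(6 + σ)) = lam ^ (-(2 * σ)) * lam ^ (-6 + σ) := by
      rw [← Real.rpow_add hlam0]
      ring_nf
    have h2 : lam ^ (-(2 * σ)) ≤
        κ ^ (-(2 * σ)) * (N : ℝ) ^ (((d : ℝ) / 2 - 1 / 4 + ε) * (-(2 * σ))) := by
      rw [Real.rpow_mul hN0.le, ← Real.mul_rpow hκ.le (by positivity)]
      exact Real.rpow_le_rpow_of_nonpos (by positivity) hlam (by linarith)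
    calc _ ≤ C * (N : ℝ) ^ ((d : ℝ) / 2 * (6 + σ) - ((d : ℝ) + 2)) *
          (κ ^ (-(2 * σ)) * (N : ℝ) ^ (((d : ℝ) / 2 - 1 / 4 + ε) * (-(2 * σ))) *
            lam ^ (-6 + σ)) := by rw [h1]; gcongr
      _ = C * κ ^ (-(2 * σ)) * (N : ℝ) ^ ((d : ℝ) / 2 * (6 + σ) - ((d : ℝ) + 2) +
            ((d : ℝ) / 2 - 1 / 4 + ε) * (-(2 * σ))) * lam ^ (-6 + σ) := by
          rw [Real.rpow_add hN0]; ring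
      _ ≤ _ := by
          gcongr
          · have h3 : σ = 4 - 4 * (1 / (1 + 6 * ε)) := by
              rw [hσ]; field_simp; ring
            have h4 : 0 < 1 / (1 + 6 * ε) := by positivity
            have h5 : 0 ≤ ε * σ := by positivity
            nlinarith
  · obtain ⟨C, hC, h⟩ := IrrationalTorus.exists_volume_levelSet_le hd (q := q) (ε := 1 / 8) (ℓ := ℓ)
      hq (by norm_num) hκ
    refine ⟨C, hC, fun θ hθ _ a N hN c hc lam hlam => h θ hθ a N hN c hc lam ?_⟩
    convert hlam using 3
    ring
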